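/- Let $\mathcal B\subset\mathcal A$ be a unital inclusion of unital C$^*$-algebras with a positive conditional expectation $E_{\mathcal B}:\mathcal A\to\mathcal B$, and let $(X_i)_{i\ge 1}$ be a sequence of self-adjoint elements of $\mathcal A$ that is centered ($E_{\mathcal B}(X_i)=0$), identically distributed over $\mathcal B$ and monotone independent over $\mathcal B$, with common variance $\eta(b)=E_{\mathcal B}(X_i b X_i)$, $b\in\mathcal B$. The operator-valued arcsine law $\mathfrak a$ of variance $\eta$ is the weak limit of the distributions of $S_N=(X_1+\dots+X_N)/\sqrt N$; that is, the positive conditional expectation $\mathfrak a:\mathcal B\langle\mathcal X\rangle\to\mathcal B$ with $\mathfrak a(p)=\lim_{N} E_{\mathcal B}(p(S_N))$ in norm for every noncommutative polynomial $p\in\mathcal B\langle\mathcal X\rangle$. This limit exists. For $m\ge1$ and $b\in M_m(\mathcal B)$ put $a_n(b)=(\mathfrak a\otimes 1_m)\big([\mathcal X b]^n\big)\in M_m(\mathcal B)$ (so $a_0(b)=1_m$), let $M_{\mathfrak a}(b)=\sum_{n\ge0}a_n(b)$, and let the $B$-transform $B_{\mathfrak a}$ be defined by $M_{\mathfrak a}(b)-1_m=B_{\mathfrak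 a}(b)\,M_{\mathfrak a}(b)$. Its coefficient $B_{n,\mathfrak a}(b)$ of order $n\ge 1$ is defined by the recurrence $a_n(b)=\sum_{k=1}^{n}B_{k,\mathfrak a}(b)\,a_{n-k}(b)$, and $B_{0,\mathfrak a}=0$. Extend $\eta$ entrywise to $M_m(\mathcal B)$. Then for every $m\ge 1$ and every $b\in M_m(\mathcal B)$, $$B_{2n,\mathfrak a}(b)=\tfrac1n\,\eta\big(b\cdot a_{2n-2}(b)\big)\cdot b\quad(n\ge1),\qquad B_{2n+1,\mathfrak a}(b)=0\quad(n\ge0).$$ Moreover there is $r>0$, independent of $m$, such that for every $b\in M_m(\mathcal B)$ with $\|b\|<r$, and also for every $b\in M_m(\mathcal B)$ that is nilpotent as a matrix over the tensor algebra of the complex vector space $\mathcal B$, the series $M_{\mathfrak a}(b)$ converges to an invertible element (so that $B_{\mathfrak a}(b)$ is well defined), $B_{\mathfrak a}(b)=\sum_{k\ge 0}B_{k,\mathfrak a}(b)$, and $$B_{\mathfrak a}(b)=\sum_{n=1}^{\infty}\frac1n\,\eta\big(b\cdot a_{2n-2}(b)\big)\cdot b .$$ -/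

import Mathlib

open Filter Topology

noncomputable section

namespace OpValued

/-! ### The star-algebra `B⟨𝒳⟩` of noncommutative polynomials with coefficients in `B` -/

section NCPoly

variable (B : Type*) [Ring B] [Algebra ℂ B]

/-- The relations that turn the free complex algebra on the symbols `some b` (`b ∈ B`) and
`none` (the indeterminate `𝒳`) into the algebra freely generated by the algebra `B` and `𝒳`. -/
inductive NCRel : FreeAlgebra ℂ (Option B) → FreeAlgebra ℂ (Option B) → Prop
  | add (b c : B) : NCRel (FreeAlgebra.ι ℂ (some (b + c)))
      (FreeAlgebra.ι ℂ (some b) + FreeAlgebra.ι ℂ (some c))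
  | mul (b c : B) : NCRel (FreeAlgebra.ι ℂ (some (b * c)))
      (FreeAlgebra.ι ℂ (some b) * FreeAlgebra.ι ℂ (some c))
  | scalar (z : ℂ) : NCRel (FreeAlgebra.ι ℂ (some (algebraMap ℂ B z)))
      (algebraMap ℂ (FreeAlgebra ℂ (Option B)) z)

/-- `B⟨𝒳⟩`: noncommutative polynomials in `𝒳` with coefficients in `B`. -/
def NCPoly : Type _ := RingQuot (NCRel B)

instance : Ring (NCPoly B) := inferInstanceAs (Ring (RingQuot (NCRel B)))
instance : Algebra ℂ (NCPoly B) := inferInstanceAs (Algebra ℂ (RingQuot (NCRel B)))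

namespace NCPoly

/-- The quotient map from the free algebra. -/
def mk : FreeAlgebra ℂ (Option B) →ₐ[ℂ] NCPoly B := RingQuot.mkAlgHom ℂ (NCRel B)

/-- The indeterminate `𝒳`. -/
def X : NCPoly B := mk B (FreeAlgebra.ι ℂ none)

/-- The inclusion of `B` into `B⟨𝒳⟩`, as an algebra homomorphism. -/
def constAlg : B →ₐ[ℂ] NCPoly B where
  toFun b := mk B (FreeAlgebra.ι ℂ (some b))
  map_one' := by
    have h := RingQuot.mkAlgHom_rel ℂ (NCRel.scalar (B := B) 1)
    rw [map_one, map_one] at h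
    exact h.trans (map_one _)
  map_mul' b c := (RingQuot.mkAlgHom_rel ℂ (NCRel.mul b c)).trans (map_mul _ _ _)
  map_zero' := by
    have h := RingQuot.mkAlgHom_rel ℂ (NCRel.scalar (B := B) 0)
    rw [map_zero, map_zero] at h
    exact h.trans (map_zero _)
  map_add' b c := (RingQuot.mkAlgHom_rel ℂ (NCRel.add b c)).trans (map_add _ _ _)
  commutes' z := (RingQuot.mkAlgHom_rel ℂ (NCRel.scalar (B := B) z)).trans
    (AlgHom.commutes _ _)

variable {B}

theorem induction {P : NCPoly B → Prop} (hC : ∀ b, P (constAlg B b)) (hX : P (X B))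
    (hadd : ∀ p q, P p → P q → P (p + q)) (hmul : ∀ p q, P p → P q → P (p * q))
    (p : NCPoly B) : P p := by
  obtain ⟨f, rfl⟩ := RingQuot.mkAlgHom_surjective ℂ (NCRel B) p
  change P (mk B f)
  induction f using FreeAlgebra.induction with
  | grade0 z =>
    rw [AlgHom.commutes, ← AlgHom.commutes (constAlg B)]
    exact hC _
  | grade1 x =>
    cases x with
    | none => exact hX
    | some b => exact hC b
  | mul a b ha hb => rw [map_mul]; exact hmul _ _ ha hb
  | add a b ha hb => rw [map_add]; exact hadd _ _ ha hb

/-- Universal property: a homomorphism on `B` and a value for `𝒳` determine a homomorphism. -/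
def lift {A : Type*} [Ring A] [Algebra ℂ A] (f : B →ₐ[ℂ] A) (x : A) : NCPoly B →ₐ[ℂ] A :=
  RingQuot.liftAlgHom ℂ ⟨FreeAlgebra.lift ℂ (fun o : Option B => o.elim x f), by
    intro p q h
    cases h <;> simp⟩

@[simp] theorem lift_const {A : Type*} [Ring A] [Algebra ℂ A] (f : B →ₐ[ℂ] A) (x : A) (b : B) :
    lift f x (constAlg B b) = f b := by
  refine (RingQuot.liftAlgHom_mkAlgHom_apply ℂ _ _ _).trans ?_
  simp

@[simp] theorem lift_X {A : Type*} [Ring A] [Algebra ℂ A] (f : B →ₐ[ℂ] A) (x : A) :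
    lift f x (X B) = x := by
  refine (RingQuot.liftAlgHom_mkAlgHom_apply ℂ _ _ _).trans ?_
  simp

/-- `p` has no free term, i.e. it vanishes under `𝒳 ↦ 0`. -/
def NoFreeTerm (p : NCPoly B) : Prop := lift (AlgHom.id ℂ B) 0 p = 0

variable (B) in
/-- The opposite algebra of `B⟨𝒳⟩` with complex scalars acting through conjugation; used only to
construct the involution. -/
def ConjOp : Type _ := (NCPoly B)ᵐᵒᵖ

instance : Ring (ConjOp B) := inferInstanceAs (Ring (NCPoly B)ᵐᵒᵖ)
instance : Algebra ℂ (ConjOp B) :=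
  ((algebraMap ℂ (NCPoly B)ᵐᵒᵖ).comp (starRingEnd ℂ)).toAlgebra' fun c x =>
    Algebra.commutes (R := ℂ) (A := (NCPoly B)ᵐᵒᵖ) (starRingEnd ℂ c) x

variable [StarRing B] [StarModule ℂ B]

/-- The involution as an algebra homomorphism into `ConjOp B`: it sends `𝒳` to `𝒳` and
`b` to `b⋆`. -/
def starHom : NCPoly B →ₐ[ℂ] ConjOp B :=
  lift (A := ConjOp B)
    { toFun := fun b => (MulOpposite.op (constAlg B (star b)) : (NCPoly B)ᵐᵒᵖ)
      map_one' := by rw [star_one, map_one]; rfl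
      map_mul' := fun b c => by rw [star_mul, map_mul]; rfl
      map_zero' := by rw [star_zero, map_zero]; rfl
      map_add' := fun b c => by rw [star_add, map_add]; rfl
      commutes' := fun z => by
        rw [← algebraMap_star_comm, AlgHom.commutes]; rfl }
    (MulOpposite.op (X B) : (NCPoly B)ᵐᵒᵖ)

instance : Star (NCPoly B) := ⟨fun p => MulOpposite.unop (α := NCPoly B) (starHom p)⟩

theorem star_const (b : B) : star (constAlg B b) = constAlg B (star b) :=
  congrArg (MulOpposite.unop (α := NCPoly B)) (lift_const (A := ConjOp B) _ _ b)

theorem star_X : star (X B) = X B :=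
  congrArg (MulOpposite.unop (α := NCPoly B)) (lift_X (A := ConjOp B) _ _)

theorem star_add_aux (p q : NCPoly B) : star (p + q) = star p + star q :=
  congrArg (MulOpposite.unop (α := NCPoly B)) (map_add starHom p q)

theorem star_mul_aux (p q : NCPoly B) : star (p * q) = star q * star p :=
  congrArg (MulOpposite.unop (α := NCPoly B)) (map_mul starHom p q)

instance : StarRing (NCPoly B) where
  star_involutive p := by
    induction p using NCPoly.induction with
    | hC b => rw [star_const, star_const, star_star]
    | hX => rw [star_X, star_X]
    | hadd p q hp hq => rw [star_add_aux, star_add_aux, hp, hq]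
    | hmul p q hp hq => rw [star_mul_aux, star_mul_aux, hp, hq]
  star_mul := star_mul_aux
  star_add := star_add_aux

variable (B) in
/-- The inclusion of `B` into `B⟨𝒳⟩`, as a star-homomorphism. -/
def C : B →⋆ₐ[ℂ] NCPoly B :=
  { constAlg B with map_star' := fun b => (star_const b).symm }

/-- Evaluation `p ↦ p(x)` at an element `x` of an algebra containing `B`. -/
def eval {A : Type*} [Ring A] [StarRing A] [Algebra ℂ A] (incl : B →⋆ₐ[ℂ] A) (x : A) :
    NCPoly B →ₐ[ℂ] A :=
  lift incl.toAlgHom x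

theorem eval_star {A : Type*} [Ring A] [StarRing A] [Algebra ℂ A] (incl : B →⋆ₐ[ℂ] A) {x : A}
    (hx : IsSelfAdjoint x) (p : NCPoly B) : eval incl x (star p) = star (eval incl x p) := by
  induction p using NCPoly.induction with
  | hC b =>
    rw [star_const, eval, lift_const, lift_const]
    exact map_star incl b
  | hX => rw [star_X, eval, lift_X, hx.star_eq]
  | hadd p q hp hq => rw [star_add, map_add, map_add, star_add, hp, hq]
  | hmul p q hp hq => rw [star_mul, map_mul, map_mul, star_mul, hp, hq]

end NCPoly

end NCPoly

/-! ### Conditional expectations, distributions, monotone independence -/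

section Prob

variable {B : Type*} [CStarAlgebra B] [PartialOrder B] [StarOrderedRing B]

/-- A positive conditional expectation of a star-algebra `A` onto `B`, where `B` is contained in
`A` through `incl` (injectivity of `incl` follows from `map_incl`). -/
structure CondExp {A : Type*} [Ring A] [StarRing A] [Algebra ℂ A] (incl : B →⋆ₐ[ℂ] A) where
  /-- the underlying linear map -/
  toLinearMap : A →ₗ[ℂ] B
  map_bimodule : ∀ (b : B) (a : A) (c : B),
    toLinearMap (incl b * a * incl c) = b * toLinearMap a * c
  map_incl : ∀ b : B, toLinearMap (incl b) = b
  nonneg : ∀ a : A, 0 ≤ toLinearMap (star a * a)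

instance {A : Type*} [Ring A] [StarRing A] [Algebra ℂ A] (incl : B →⋆ₐ[ℂ] A) :
    CoeFun (CondExp incl) (fun _ => A → B) := ⟨fun E => E.toLinearMap⟩

variable (B) in
/-- Positive conditional expectations `B⟨𝒳⟩ → B`, i.e. `B`-valued distributions. -/
abbrev Distribution : Type _ := CondExp (NCPoly.C B)

variable {A : Type*} [CStarAlgebra A] {incl : B →⋆ₐ[ℂ] A}

/-- The distribution `p ↦ E (p(x))` of a self-adjoint `x`. -/
def law (E : CondExp incl) (x : A) (hx : IsSelfAdjoint x) : Distribution B where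
  toLinearMap := E.toLinearMap ∘ₗ (NCPoly.eval incl x).toLinearMap
  map_bimodule b p c := by
    have h : ∀ d : B, NCPoly.eval incl x (NCPoly.C B d) = incl d :=
      fun d => NCPoly.lift_const _ _ d
    simp only [LinearMap.comp_apply, AlgHom.toLinearMap_apply, map_mul, h, E.map_bimodule]
  map_incl b := by
    have h : NCPoly.eval incl x (NCPoly.C B b) = incl b := NCPoly.lift_const _ _ b
    simp only [LinearMap.comp_apply, AlgHom.toLinearMap_apply, h, E.map_incl]
  nonneg p := by
    simp only [LinearMap.comp_apply, AlgHom.toLinearMap_apply, map_mul,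
      NCPoly.eval_star incl hx]
    exact E.nonneg _

/-- Monotone independence over `B` of a family indexed by a linear order: in an alternating
product of elements `a l ∈ B⟨X (ε l)⟩₀`, any factor whose index exceeds those of its (existing)
neighbours may be replaced by its conditional expectation. -/
def MonotoneIndep {I : Type*} [LinearOrder I] (E : CondExp incl) (X : I → A) : Prop :=
  ∀ (n : ℕ) (ε : Fin n → I) (a : Fin n → A),
    (∀ l, ∃ p : NCPoly B, p.NoFreeTerm ∧ a l = NCPoly.eval incl (X (ε l)) p) →
    (∀ k l : Fin n, (k : ℕ) + 1 = l → ε k ≠ ε l) →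
    ∀ j : Fin n, (∀ k : Fin n, (k : ℕ) + 1 = j ∨ (j : ℕ) + 1 = k → ε k < ε j) →
      E (List.ofFn a).prod = E (List.ofFn (Function.update a j (incl (E (a j))))).prod

/-- `S_N = (X_0 + ⋯ + X_{N-1}) / √N`. -/
def normalizedSum (X : ℕ → A) (N : ℕ) : A :=
  (Real.sqrt N)⁻¹ • ∑ i ∈ Finset.range N, X i

theorem normalizedSum_isSelfAdjoint {X : ℕ → A} (hX : ∀ i, IsSelfAdjoint (X i)) (N : ℕ) :
    IsSelfAdjoint (normalizedSum X N) := by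
  refine IsSelfAdjoint.smul (IsSelfAdjoint.all _) ?_
  exact isSelfAdjoint_sum _ fun i _ => hX i

/-- Weak convergence of distributions: convergence on every polynomial. -/
def WeakLimit (σ : ℕ → Distribution B) (μ : Distribution B) : Prop :=
  ∀ p : NCPoly B, Tendsto (fun N => σ N p) atTop (𝓝 (μ p))

/-! ### Fully matricial moments and the `B`-transform -/

/-- `M_m(B)` with its C⋆-norm. -/
abbrev Mat (m : ℕ) (B : Type*) : Type _ := CStarMatrix (Fin m) (Fin m) B

/-- The fully matricial moment `(μ ⊗ 1_m)([𝒳 b]^n)`, for `b ∈ M_m(B)`. -/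
def moment (μ : Distribution B) {m : ℕ} (n : ℕ) (b : Mat m B) : Mat m B :=
  CStarMatrix.ofMatrix
    (((Matrix.of fun i j => NCPoly.X B * NCPoly.C B (b i j)) ^ n).map fun p => μ p)

/-- The moment-generating series `M_μ(b)`. -/
def momentSeries (μ : Distribution B) {m : ℕ} (b : Mat m B) : Mat m B :=
  ∑' n, moment μ n b

/-- The `B`-transform: the solution `β = B_μ(b)` of `M_μ(b) - 1 = β * M_μ(b)`, unique wherever
`M_μ(b)` is invertible. -/
def BTransform (μ : Distribution B) {m : ℕ} (b : Mat m B) : Mat m B :=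
  (momentSeries μ b - 1) * Ring.inverse (momentSeries μ b)

/-- The homogeneous component of degree `n` of the `B`-transform, given by the recurrence
`moment n = ∑_{k = 1}^{n} BCoeff k * moment (n - k)` for `n ≥ 1`. -/
def BCoeff (μ : Distribution B) {m : ℕ} : ℕ → Mat m B → Mat m B
  | 0, _ => 0
  | n + 1, b => moment μ (n + 1) b - ∑ k : Fin (n + 1), BCoeff μ k b * moment μ (n + 1 - k) b

/-- `b ∈ M_m(B)` is nilpotent when viewed as a matrix over the tensor algebra of the complex
vector space `B`. -/
def IsTensorNilpotent {m : ℕ} (b : Mat m B) : Prop :=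
  ∃ r : ℕ, (Matrix.of fun i j => TensorAlgebra.ι ℂ (b i j)) ^ r = 0

end Prob

end OpValued

end

/-! Let M_x(b) be the formal series of the moments (E ⊗ 1_m)([x b]^n). If x has a lower index than
every summand of Y, monotone independence lets each block of Y's in a word in x and Y be replaced by
its expectation. Summing over words gives M_{x+Y}(b) = M_Y(b) · M_x(b M_Y(b)), whose homogeneous
form is `MonotoneIndep.matrixMoment_add`. Identical distribution turns this into a recursion in N
for the moments a_N(n) of X_0 + ⋯ + X_{N-1} (`MonotoneIndep.matrixMoment_sum_succ`).

In a_{N+1}(n+2) - a_N(n+2) the terms with a single x vanish by centering, those with two produce η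
and have order N^{n/2}, and those with more have lower order. Stolz–Cesàro against N^{(n+2)/2} then
gives convergence of the normalized moments and, in the limit, a_{n+2} = 2/(n+2) ∑ a_i η(b a_j) b
a_k over i + j + k = n (`exists_tendsto_moment`).

With D the Euler operator (multiplication by the degree), this reads D M = 2 M g M where g = η(b M)
b. Let β have no constant term and satisfy D β = 2 g. Then u = M - β M satisfies D u = 2 (u - 1) g M
with constant term 1, which forces u = 1 (`eq_one_add_mul_of_eulerOp`). So β is the B-transform, and
dividing 2 g by the degree gives the asserted coefficients.

Working with matrices also settles existence of the limit law, since every word is, up to a left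
coefficient, an entry of a power of a superdiagonal matrix. For convergence of the series,
Kadison–Schwarz bounds η on matrices uniformly in m (`exists_covariance_bound`), and a quadratic
majorant does the rest (`summable_of_quadratic_recurrence`). Tensor-nilpotent matrices have only
finitely many nonzero moments. -/

open Finset.HasAntidiagonal

noncomputable section

namespace OpValued

set_option linter.unusedSectionVars false

/-! ### Norm estimates for positive conditional expectations -/

section Norm

variable {B : Type*} [CStarAlgebra B] [PartialOrder B] [StarOrderedRing B]
  {A : Type*} [CStarAlgebra A] {incl : B →⋆ₐ[ℂ] A}

namespace CondExp

theorem map_incl_mul (E : CondExp incl) (b : B) (a : A) : E (incl b * a) = b * E a := by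
  simpa using E.map_bimodule b a 1

theorem map_mul_incl (E : CondExp incl) (a : A) (b : B) : E (a * incl b) = E a * b := by
  simpa using E.map_bimodule 1 a b

theorem map_one (E : CondExp incl) : E (1 : A) = 1 := by
  simpa using E.map_incl 1

/-- A positive conditional expectation as a positive linear map. -/
def toPositive [PartialOrder A] [StarOrderedRing A] (E : CondExp incl) : A →ₚ[ℂ] B :=
  PositiveLinearMap.mk₀ E.toLinearMap fun a ha => by
    obtain ⟨c, rfl⟩ := CStarAlgebra.nonneg_iff_eq_star_mul_self.mp ha
    exact E.nonneg c

/-- Positive linear maps between C⋆-algebras are automatically bounded; the spectral order supplies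
the order on `A`. Only some constant is needed, not contractivity. -/
theorem exists_bound (E : CondExp incl) : ∃ K : ℝ, 0 ≤ K ∧ ∀ a : A, ‖E a‖ ≤ K * ‖a‖ := by
  let _ := CStarAlgebra.spectralOrder A
  let _ := CStarAlgebra.spectralOrderedRing A
  obtain ⟨C, hC⟩ := PositiveLinearMap.exists_norm_apply_le E.toPositive
  exact ⟨C, C.2, hC⟩

theorem continuous (E : CondExp incl) : Continuous E := by
  obtain ⟨K, -, hK⟩ := E.exists_bound
  exact (LinearMap.mkContinuousOfExistsBound E.toLinearMap ⟨K, hK⟩).continuous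

theorem map_star_apply (E : CondExp incl) (a : A) : E (star a) = star (E a) := by
  let _ := CStarAlgebra.spectralOrder A
  let _ := CStarAlgebra.spectralOrderedRing A
  exact map_star E.toPositive a

/-- The Kadison–Schwarz inequality. -/
theorem mul_star_le (E : CondExp incl) (w : A) : E w * star (E w) ≤ E (w * star w) := by
  -- This is E((w - E w)(w - E w)⋆) ≥ 0, expanded by the bimodule property.
  have h := E.nonneg (star w - incl (star (E w)))
  have e : star (star w - incl (star (E w))) * (star w - incl (star (E w))) =
      w * star w - w * incl (star (E w)) - incl (E w) * star w + incl (E w * star (E w)) := by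
    rw [star_sub, star_star, ← map_star, star_star, map_mul]
    noncomm_ring
  rw [e, map_add, map_sub, map_sub, E.map_mul_incl, E.map_incl_mul, E.map_incl,
    E.map_star_apply] at h
  rw [← sub_nonneg]
  convert h using 1
  abel

end CondExp

/-- Diagonal matrices with constant diagonal, as a star-homomorphism. -/
def constDiagonal (A : Type*) [CStarAlgebra A] [PartialOrder A] [StarOrderedRing A] (m : ℕ) :
    A →⋆ₙₐ[ℂ] Mat m A where
  toFun a := CStarMatrix.ofMatrix (Matrix.diagonal fun _ => a)
  map_smul' z a := by
    ext i j
    by_cases h : i = j <;> simp [h]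
  map_zero' := by ext i j; simp
  map_add' a c := by
    ext i j
    by_cases h : i = j <;> simp [h]
  map_mul' a c := by
    exact congrArg CStarMatrix.ofMatrix (Matrix.diagonal_mul_diagonal (fun _ => a) _).symm
  map_star' a := by
    ext i j
    by_cases h : i = j
    · subst h; simp [CStarMatrix.star_apply]
    · simp [CStarMatrix.star_apply, h, Ne.symm h]

/-- The norm of a C⋆-matrix is its operator norm on the Hilbert module of row vectors; both sides
are the squares of such norms. -/
theorem vecMul_norm_sq_le {m : ℕ} [PartialOrder A] [StarOrderedRing A] (T : Mat m A)
    (u : Fin m → A) :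
    ‖∑ j, (∑ i, u i * T i j) * star (∑ i, u i * T i j)‖ ≤
      ‖T‖ ^ 2 * ‖∑ i, u i * star (u i)‖ := by
  have h := (CStarMatrix.toCLM T).le_opNorm ((WithCStarModule.equiv _ _).symm u)
  have h2 := pow_le_pow_left₀ (norm_nonneg _) h 2
  rw [mul_pow, WithCStarModule.pi_norm_sq, WithCStarModule.pi_norm_sq,
    CStarMatrix.toCLM_apply_eq_sum] at h2
  exact h2

/-- The amplifications of `b ↦ E (x b x)` to matrices are bounded, uniformly in the size. -/
theorem exists_covariance_bound (E : CondExp incl) (x : A) (η : B → B)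
    (hη : ∀ b, E (x * incl b * x) = η b) :
    ∃ K : ℝ, 0 ≤ K ∧ ∀ (m : ℕ) (c : Mat m B), ‖c.map η‖ ≤ K * ‖c‖ := by
  let _ := CStarAlgebra.spectralOrder A
  let _ := CStarAlgebra.spectralOrderedRing A
  obtain ⟨K, hK0, hK⟩ := E.exists_bound
  -- The bound `K` for `E` is applied to a squared vector norm, hence the square root. The size `m`
  -- enters nowhere.
  refine ⟨√K * ‖x‖ ^ 2, by positivity, fun m c => ?_⟩
  have hincl : ∀ b : B, ‖incl b‖ ≤ ‖b‖ := fun b => NonUnitalStarAlgHom.norm_apply_le incl b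
  set D : Mat m A := constDiagonal A m x with hD
  have hDn : ‖D‖ ≤ ‖x‖ := NonUnitalStarAlgHom.norm_apply_le (constDiagonal A m) x
  set c' : Mat m A := c.map incl with hc'
  have hcn : ‖c'‖ ≤ ‖c‖ :=
    NonUnitalStarAlgHom.norm_apply_le
      (CStarMatrix.mapₙₐ (n := Fin m) (incl : B →⋆ₙₐ[ℂ] A)) c
  set T : Mat m A := D * c' * D with hT
  have hTn : ‖T‖ ≤ ‖x‖ ^ 2 * ‖c‖ := by
    calc ‖T‖ ≤ ‖D‖ * ‖c'‖ * ‖D‖ := norm_mul₃_le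
      _ ≤ ‖x‖ * ‖c‖ * ‖x‖ := by gcongr
      _ = _ := by ring
  have hTe : ∀ i j, T i j = x * incl (c i j) * x := fun i j => by
    have h (M : Matrix (Fin m) (Fin m) A) :
        (Matrix.diagonal (fun _ => x) * M * Matrix.diagonal (fun _ => x) :
          Matrix (Fin m) (Fin m) A) i j = x * M i j * x := by
      rw [Matrix.mul_diagonal, Matrix.diagonal_mul]
    exact h (c.map incl)
  rw [CStarMatrix.norm_def]
  refine ContinuousLinearMap.opNorm_le_bound _ (by positivity) fun v => ?_
  set w : Fin m → A := fun j => ∑ i, incl (v i) * T i j with hw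
  have hEw : ∀ j, E (w j) = ∑ i, v i * η (c i j) := fun j => by
    simp only [hw, map_sum, E.map_incl_mul, hTe, hη]
  refine (sq_le_sq₀ (norm_nonneg _) (by positivity)).mp ?_
  rw [mul_pow, WithCStarModule.pi_norm_sq, WithCStarModule.pi_norm_sq,
    CStarMatrix.toCLM_apply_eq_sum]
  change ‖∑ j, (∑ i, v i * η (c i j)) * star (∑ i, v i * η (c i j))‖ ≤
    _ * ‖∑ i, v i * star (v i)‖
  simp only [← hEw]
  -- Kadison–Schwarz is used on each entry of the row vector `w`, so positivity of `E` on `A` itself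
  -- suffices and no complete positivity is invoked.
  calc ‖∑ j, E (w j) * star (E (w j))‖
      ≤ ‖E (∑ j, w j * star (w j))‖ := by
        rw [map_sum]
        exact CStarAlgebra.norm_le_norm_of_nonneg_of_le
          (Finset.sum_nonneg fun j _ => mul_star_self_nonneg _)
          (Finset.sum_le_sum fun j _ => E.mul_star_le _)
    _ ≤ K * ‖∑ j, w j * star (w j)‖ := hK _
    _ ≤ K * (‖T‖ ^ 2 * ‖∑ i, incl (v i) * star (incl (v i))‖) := by
        gcongr
        exact vecMul_norm_sq_le T _
    _ = K * (‖T‖ ^ 2 * ‖incl (∑ i, v i * star (v i))‖) := by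
        simp only [map_sum, map_mul, map_star]
    _ ≤ K * ((‖x‖ ^ 2 * ‖c‖) ^ 2 * ‖∑ i, v i * star (v i)‖) := by
        gcongr
        exact hincl _
    _ = (√K * ‖x‖ ^ 2 * ‖c‖) ^ 2 * ‖∑ i, v i * star (v i)‖ := by
        rw [mul_pow, mul_pow, mul_pow, Real.sq_sqrt hK0]
        ring

end Norm

/-! ### Words in a monotone independent family -/

section Words

variable {B : Type*} [CStarAlgebra B] [PartialOrder B] [StarOrderedRing B]
  {A : Type*} [CStarAlgebra A] {incl : B →⋆ₐ[ℂ] A}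

theorem NCPoly.eval_C (incl : B →⋆ₐ[ℂ] A) (x : A) (b : B) :
    NCPoly.eval incl x (NCPoly.C B b) = incl b :=
  NCPoly.lift_const _ _ b

theorem NCPoly.eval_X (incl : B →⋆ₐ[ℂ] A) (x : A) :
    NCPoly.eval incl x (NCPoly.X B) = x :=
  NCPoly.lift_X _ _

variable (incl) in
/-- Membership in the algebra of polynomials in `x` without free term. -/
def IsPolyAt (x a : A) : Prop := ∃ p : NCPoly B, p.NoFreeTerm ∧ a = NCPoly.eval incl x p

namespace IsPolyAt

variable {x a c : A}

theorem self : IsPolyAt incl x x :=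
  ⟨NCPoly.X B, NCPoly.lift_X _ _, (NCPoly.eval_X incl x).symm⟩

theorem mul (ha : IsPolyAt incl x a) (hc : IsPolyAt incl x c) : IsPolyAt incl x (a * c) := by
  obtain ⟨p, hp, rfl⟩ := ha
  obtain ⟨q, hq, rfl⟩ := hc
  refine ⟨p * q, ?_, (map_mul _ _ _).symm⟩
  rw [NCPoly.NoFreeTerm] at *
  rw [map_mul, hp, zero_mul]

theorem mul_incl (ha : IsPolyAt incl x a) (b : B) : IsPolyAt incl x (a * incl b) := by
  obtain ⟨p, hp, rfl⟩ := ha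
  refine ⟨p * NCPoly.C B b, ?_, by rw [map_mul, NCPoly.eval_C]⟩
  rw [NCPoly.NoFreeTerm] at *
  rw [map_mul, hp, zero_mul]

theorem incl_mul (ha : IsPolyAt incl x a) (b : B) : IsPolyAt incl x (incl b * a) := by
  obtain ⟨p, hp, rfl⟩ := ha
  refine ⟨NCPoly.C B b * p, ?_, by rw [map_mul, NCPoly.eval_C]⟩
  rw [NCPoly.NoFreeTerm] at *
  rw [map_mul, hp, mul_zero]

end IsPolyAt

/-- The defining property in terms of lists of pairs (index, element), a form suited to
concatenation. The peak has at most two neighbours: the last entry of `l₁` and the first of `l₂`. -/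
theorem MonotoneIndep.peak_list {E : CondExp incl} {X : ℕ → A} (h : MonotoneIndep E X)
    (l₁ l₂ : List (ℕ × A)) (k : ℕ) (g : A) (hg : IsPolyAt incl (X k) g)
    (h₁ : ∀ x ∈ l₁, IsPolyAt incl (X x.1) x.2) (h₂ : ∀ x ∈ l₂, IsPolyAt incl (X x.1) x.2)
    (c₁ : l₁.IsChain fun x y => x.1 ≠ y.1) (c₂ : l₂.IsChain fun x y => x.1 ≠ y.1)
    (b₁ : ∀ x ∈ l₁.getLast?, x.1 < k) (b₂ : ∀ x ∈ l₂.head?, x.1 < k) :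
    E ((l₁.map Prod.snd).prod * (g * (l₂.map Prod.snd).prod)) =
      E ((l₁.map Prod.snd).prod * (incl (E g) * (l₂.map Prod.snd).prod)) := by
  set l := l₁ ++ (k, g) :: l₂ with hl
  have hall : ∀ x ∈ l, IsPolyAt incl (X x.1) x.2 := by
    intro x hx
    rw [hl, List.mem_append, List.mem_cons] at hx
    rcases hx with hx | rfl | hx
    exacts [h₁ x hx, hg, h₂ x hx]
  have hchain : l.IsChain fun x y => x.1 ≠ y.1 := by
    rw [hl, List.isChain_append, List.isChain_cons]
    refine ⟨c₁, ⟨fun y hy => (b₂ y hy).ne', c₂⟩, fun x hx y hy => ?_⟩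
    simp only [List.head?_cons, Option.mem_def, Option.some.injEq] at hy
    subst hy
    exact (b₁ x hx).ne
  have hlen : l₁.length < l.length := by simp [hl]
  have key := h l.length (fun i => l[i].1) (fun i => l[i].2)
    (fun i => hall _ (List.getElem_mem _))
    (fun i j hij => by
      have := List.isChain_iff_getElem.mp hchain i (by omega)
      simpa [hij] using this)
    ⟨l₁.length, hlen⟩ (fun i hi => by
      have hk : l[l₁.length] = (k, g) := by simp [hl]
      simp only [Fin.getElem_fin, hk]
      rcases hi with hi | hi
      · apply b₁
        have : l[(i : ℕ)] = l₁[(i : ℕ)]'(by simp at hi; omega) := by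
          simp only [hl]
          rw [List.getElem_append_left]
        rw [this, Option.mem_def, List.getLast?_eq_getElem?, List.getElem?_eq_some_iff]
        simp only at hi
        refine ⟨by omega, ?_⟩
        congr 1
        omega
      · apply b₂
        simp only at hi
        have hi' := i.2
        have hlen' : l.length = l₁.length + (l₂.length + 1) := by simp [hl]
        have : l[(i : ℕ)] = l₂[0]'(by omega) := by
          simp only [hl, ← hi]
          rw [List.getElem_append_right (by omega)]
          simp
        rw [this, Option.mem_def, List.head?_eq_getElem?, List.getElem?_eq_some_iff]
        exact ⟨by omega, rfl⟩)
  have e1 : List.ofFn (fun i : Fin l.length => l[i].2) =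
      l₁.map Prod.snd ++ g :: l₂.map Prod.snd := by
    apply List.ext_getElem
    · simp [hl, add_assoc]
    · intro i hi hi'
      have : l₁.map Prod.snd ++ g :: l₂.map Prod.snd = l.map Prod.snd := by simp [hl]
      simp [this]
  have e2 : ∀ v : A, List.ofFn (Function.update (fun i : Fin l.length => l[i].2)
      ⟨l₁.length, hlen⟩ v) = l₁.map Prod.snd ++ v :: l₂.map Prod.snd := by
    intro v
    have : List.ofFn (Function.update (fun i : Fin l.length => l[i].2) ⟨l₁.length, hlen⟩ v) =
        (List.ofFn (fun i : Fin l.length => l[i].2)).set l₁.length v := by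
      apply List.ext_getElem
      · simp
      · intro i hi hi'
        simp only [List.getElem_ofFn, List.getElem_set, Function.update_apply, Fin.ext_iff]
        split_ifs <;> first | rfl | omega
    rw [this, e1, List.set_append]
    simp
  have e3 : l[l₁.length].2 = g := by simp [hl]
  rw [e2, e1] at key
  simpa [e3] using key

variable (incl) in
/-- Words with coefficients in `B` whose last letter is `o` (`none` for words without letters). -/
inductive WordEnding (X : ℕ → A) : Option ℕ → A → Prop
  | const (c : B) : WordEnding X none (incl c)
  | snoc {o : Option ℕ} {a : A} (ha : WordEnding X o a) (i : ℕ) (b : B) :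
      WordEnding X (some i) (a * (X i * incl b))

variable (incl) in
/-- Words with coefficients in `B` whose first letter is `o` (`none` for words without letters). -/
inductive WordStarting (X : ℕ → A) : Option ℕ → A → Prop
  | const (c : B) : WordStarting X none (incl c)
  | cons {o : Option ℕ} {a : A} (ha : WordStarting X o a) (i : ℕ) (b : B) :
      WordStarting X (some i) (incl b * (X i * a))

theorem WordEnding.mul_incl {X : ℕ → A} {o : Option ℕ} {a : A} (h : WordEnding incl X o a)
    (c : B) : WordEnding incl X o (a * incl c) := by
  cases h with
  | const d => rw [← map_mul]; exact .const _
  | snoc ha i b =>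
    rw [mul_assoc, mul_assoc, ← map_mul]
    exact .snoc ha i _

theorem WordStarting.incl_mul {X : ℕ → A} {o : Option ℕ} {a : A} (h : WordStarting incl X o a)
    (c : B) : WordStarting incl X o (incl c * a) := by
  cases h with
  | const d => rw [← map_mul]; exact .const _
  | cons ha i b =>
    rw [← mul_assoc, ← map_mul]
    exact .cons ha i _

/-- Consecutive letters with the same index are merged into one polynomial without free term. The
leading coefficient has a free term and must stay outside the alternating product. -/
theorem WordEnding.exists_alternating {X : ℕ → A} {o : Option ℕ} {a : A}
    (h : WordEnding incl X o a) : ∃ (c : B) (l : List (ℕ × A)),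
      a = incl c * (l.map Prod.snd).prod ∧ (∀ x ∈ l, IsPolyAt incl (X x.1) x.2) ∧
      (l.IsChain fun x y => x.1 ≠ y.1) ∧ ∀ x ∈ l.getLast?, x.1 ∈ o := by
  induction h with
  | const c => exact ⟨c, [], by simp, by simp, by simp, by simp⟩
  | @snoc o a ha i b ih =>
    obtain ⟨c, l, rfl, hl, hc, -⟩ := ih
    have hi : IsPolyAt incl (X i) (X i * incl b) := IsPolyAt.self.mul_incl b
    by_cases hlast : ∀ x ∈ l.getLast?, x.1 ≠ i
    · refine ⟨c, l ++ [(i, X i * incl b)], by simp [mul_assoc], ?_, ?_, by simp⟩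
      · intro x hx
        rw [List.mem_append, List.mem_singleton] at hx
        rcases hx with hx | rfl
        exacts [hl x hx, hi]
      · rw [List.isChain_append]
        refine ⟨hc, by simp, fun x hx y hy => ?_⟩
        simp only [List.head?_cons, Option.mem_def, Option.some.injEq] at hy
        subst hy
        exact hlast x hx
    · rcases List.eq_nil_or_concat l with rfl | ⟨l', x, rfl⟩
      · simp at hlast
      · obtain ⟨j, y⟩ := x
        simp only [List.concat_eq_append, List.getLast?_append, List.getLast?_singleton] at *
        simp only [Option.mem_def, Option.some_or, Option.some.injEq, forall_eq', ne_eq,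
          not_not] at hlast
        subst hlast
        refine ⟨c, l' ++ [(j, y * (X j * incl b))], by simp [mul_assoc], ?_, ?_, by simp⟩
        · intro x hx
          rw [List.mem_append, List.mem_singleton] at hx
          rcases hx with hx | rfl
          · exact hl x (by simp [hx])
          · exact (hl (j, y) (by simp)).mul hi
        · rw [List.isChain_append] at hc ⊢
          refine ⟨hc.1, by simp, fun x hx z hz => ?_⟩
          have := hc.2.2 x hx (j, y) (by simp)
          simp only [List.head?_cons, Option.mem_def, Option.some.injEq] at hz
          subst hz
          exact this

theorem WordStarting.exists_alternating {X : ℕ → A} {o : Option ℕ} {a : A}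
    (h : WordStarting incl X o a) : ∃ (c : B) (l : List (ℕ × A)),
      a = (l.map Prod.snd).prod * incl c ∧ (∀ x ∈ l, IsPolyAt incl (X x.1) x.2) ∧
      (l.IsChain fun x y => x.1 ≠ y.1) ∧ ∀ x ∈ l.head?, x.1 ∈ o := by
  induction h with
  | const c => exact ⟨c, [], by simp, by simp, by simp, by simp⟩
  | @cons o a ha i b ih =>
    obtain ⟨c, l, rfl, hl, hc, -⟩ := ih
    have hi : IsPolyAt incl (X i) (incl b * X i) := IsPolyAt.self.incl_mul b
    cases l with
    | nil => exact ⟨c, [(i, incl b * X i)], by simp [mul_assoc], by simpa using hi, by simp, by simp⟩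
    | cons x l =>
      obtain ⟨j, y⟩ := x
      by_cases hij : i = j
      · subst hij
        refine ⟨c, (i, incl b * X i * y) :: l, by simp [mul_assoc], ?_, ?_, by simp⟩
        · intro x hx
          rw [List.mem_cons] at hx
          rcases hx with rfl | hx
          · exact hi.mul (hl (i, y) (by simp))
          · exact hl x (by simp [hx])
        · rw [List.isChain_cons] at hc ⊢
          exact hc
      · refine ⟨c, (i, incl b * X i) :: (j, y) :: l, by simp [mul_assoc], ?_, ?_, by simp⟩
        · intro x hx
          rw [List.mem_cons] at hx
          rcases hx with rfl | hx
          exacts [hi, hl x hx]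
        · rw [List.isChain_cons]
          exact ⟨by simpa using hij, hc⟩

/-- A peak of a word may be replaced by its conditional expectation. -/
theorem MonotoneIndep.peak {E : CondExp incl} {X : ℕ → A} (h : MonotoneIndep E X) {k : ℕ}
    {o o' : Option ℕ} {a g a' : A} (ha : WordEnding incl X o a) (ho : ∀ i ∈ o, i < k)
    (hg : IsPolyAt incl (X k) g) (ha' : WordStarting incl X o' a') (ho' : ∀ i ∈ o', i < k) :
    E (a * (g * a')) = E (a * (incl (E g) * a')) := by
  obtain ⟨c, l, rfl, hl, hc, hlast⟩ := ha.exists_alternating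
  obtain ⟨c', l', rfl, hl', hc', hfirst⟩ := ha'.exists_alternating
  have key := h.peak_list l l' k g hg hl hl' hc hc' (fun x hx => ho _ (hlast x hx))
    (fun x hx => ho' _ (hfirst x hx))
  have e : ∀ u : A, E (incl c * (l.map Prod.snd).prod * (u * ((l'.map Prod.snd).prod * incl c'))) =
      c * E ((l.map Prod.snd).prod * (u * (l'.map Prod.snd).prod)) * c' := by
    intro u
    rw [← E.map_bimodule]
    simp only [mul_assoc]
  rw [e, e, key]

end Words

/-- Selects the first run of letters of index `k`. When `k` is the largest index in the word, both
neighbours of the run are strictly lower, so the run is a peak. -/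
theorem exists_maximal_run {α : Type*} (k : ℕ) (w : List (ℕ × α)) (hw : ∃ x ∈ w, x.1 = k) :
    ∃ w₁ g w₂, w = w₁ ++ (g ++ w₂) ∧ g ≠ [] ∧ (∀ x ∈ w₁, x.1 ≠ k) ∧ (∀ x ∈ g, x.1 = k) ∧
      ∀ x ∈ w₂.head?, x.1 ≠ k := by
  induction w with
  | nil => simp at hw
  | cons y w ih =>
    by_cases hy : y.1 = k
    · refine ⟨[], y :: w.takeWhile (fun x => x.1 = k), w.dropWhile (fun x => x.1 = k), by simp,
        by simp, by simp, ?_, ?_⟩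
      · intro x hx
        rw [List.mem_cons] at hx
        rcases hx with rfl | hx
        · exact hy
        · simpa using List.mem_takeWhile_imp hx
      · intro x hx
        have := List.head?_dropWhile_not (fun x : ℕ × α => x.1 = k) w
        rw [Option.mem_def] at hx
        simpa [hx] using this
    · obtain ⟨w₁, g, w₂, rfl, hg, h1, h2, h3⟩ := ih (by simpa [hy] using hw)
      refine ⟨y :: w₁, g, w₂, by simp, hg, ?_, h2, h3⟩
      intro x hx
      rw [List.mem_cons] at hx
      rcases hx with rfl | hx
      exacts [hy, h1 x hx]

/-! ### Decoupling a block of letters of high index. -/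

section Words

variable {B : Type*} [CStarAlgebra B] [PartialOrder B] [StarOrderedRing B]
  {A : Type*} [CStarAlgebra A] {incl : B →⋆ₐ[ℂ] A}

variable (incl) in
/-- The product `X i₁ b₁ X i₂ b₂ ⋯` attached to a list of pairs `(i, b)`. -/
def word (X : ℕ → A) (w : List (ℕ × B)) : A := (w.map fun x => X x.1 * incl x.2).prod

@[simp] theorem word_nil (X : ℕ → A) : word incl X [] = 1 := rfl

@[simp] theorem word_cons (X : ℕ → A) (x : ℕ × B) (w : List (ℕ × B)) :
    word incl X (x :: w) = X x.1 * incl x.2 * word incl X w := by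
  simp [word]

@[simp] theorem word_append (X : ℕ → A) (w w' : List (ℕ × B)) :
    word incl X (w ++ w') = word incl X w * word incl X w' := by
  simp [word]

theorem exists_word_mul_incl (X : ℕ → A) (w : List (ℕ × B)) (hw : w ≠ []) (c : B) :
    ∃ w', w'.map Prod.fst = w.map Prod.fst ∧ word incl X w * incl c = word incl X w' := by
  obtain ⟨v, x, rfl⟩ := (List.eq_nil_or_concat w).resolve_left hw
  exact ⟨v ++ [(x.1, x.2 * c)], by simp, by simp [mul_assoc]⟩

theorem isPolyAt_word {X : ℕ → A} {k : ℕ} (w : List (ℕ × B)) (hw : w ≠ [])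
    (hk : ∀ x ∈ w, x.1 = k) : IsPolyAt incl (X k) (word incl X w) := by
  induction w with
  | nil => exact absurd rfl hw
  | cons x w ih =>
    obtain rfl : x.1 = k := hk x (by simp)
    rw [word_cons]
    by_cases h : w = []
    · subst h
      simpa using IsPolyAt.self.mul_incl x.2
    · exact (IsPolyAt.self.mul_incl x.2).mul (ih h fun y hy => hk y (by simp [hy]))

theorem WordEnding.mul_word {X : ℕ → A} {o : Option ℕ} {a : A} (ha : WordEnding incl X o a)
    {k : ℕ} (ho : ∀ i ∈ o, i < k) (w : List (ℕ × B)) (hw : ∀ x ∈ w, x.1 < k) :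
    ∃ o', WordEnding incl X o' (a * word incl X w) ∧ ∀ i ∈ o', i < k := by
  induction w generalizing o a with
  | nil => exact ⟨o, by simpa using ha, ho⟩
  | cons x w ih =>
    rw [word_cons, ← mul_assoc]
    exact ih (.snoc ha x.1 x.2) (by simpa using hw x (by simp)) fun y hy => hw y (by simp [hy])

theorem WordStarting.word_mul {X : ℕ → A} {o : Option ℕ} {a : A} (ha : WordStarting incl X o a)
    {k : ℕ} (ho : ∀ i ∈ o, i < k) (w : List (ℕ × B)) (hw : ∀ x ∈ w.head?, x.1 < k) :
    ∃ o', WordStarting incl X o' (word incl X w * a) ∧ ∀ i ∈ o', i < k := by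
  have aux : ∀ w : List (ℕ × B), ∃ o', WordStarting incl X o' (word incl X w * a) := by
    intro w
    induction w with
    | nil => exact ⟨o, by simpa using ha⟩
    | cons x w ih =>
      obtain ⟨o', h⟩ := ih
      refine ⟨some x.1, ?_⟩
      have := (h.incl_mul x.2).cons x.1 1
      simpa [mul_assoc] using this
  cases w with
  | nil => exact ⟨o, by simpa using ha, ho⟩
  | cons x w =>
    obtain ⟨o', h⟩ := aux w
    refine ⟨some x.1, ?_, by simpa using hw x (by simp)⟩
    have := (h.incl_mul x.2).cons x.1 1
    simpa [mul_assoc] using this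

/-- A word in letters with large indices, between words ending and starting with smaller
indices, may be replaced by its conditional expectation. -/
theorem MonotoneIndep.decouple_word {E : CondExp incl} {X : ℕ → A} (h : MonotoneIndep E X) {s : ℕ}
    {o o' : Option ℕ} {a a' : A} (ha : WordEnding incl X o a) (ho : ∀ i ∈ o, i < s)
    (ha' : WordStarting incl X o' a') (ho' : ∀ i ∈ o', i < s)
    (w : List (ℕ × B)) (hw : ∀ x ∈ w, s ≤ x.1) :
    E (a * (word incl X w * a')) = E (a * (incl (E (word incl X w)) * a')) := by
  -- The run at the largest index is replaced by its expectation, an element of `B` that is absorbed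
  -- into a neighbouring coefficient; this shortens the word.
  induction hn : w.length using Nat.strong_induction_on generalizing w o a with
  | _ n ih =>
  by_cases hnil : w = []
  · subst hnil
    simp [E.map_one]
  obtain ⟨m, hm, hmax⟩ : ∃ m ∈ w, ∀ x ∈ w, x.1 ≤ m.1 := by
    obtain ⟨m, hm⟩ := Option.ne_none_iff_exists'.mp (mt (List.argmax_eq_none (f := Prod.fst)).mp hnil)
    exact ⟨m, List.argmax_mem hm, fun x hx => List.le_of_mem_argmax (f := Prod.fst) hx hm⟩
  obtain ⟨w₁, g, w₂, rfl, hg, h1, h2, h3⟩ := exists_maximal_run m.1 w ⟨m, hm, rfl⟩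
  set k := m.1
  have hsk : s ≤ k := hw m hm
  have h1' : ∀ x ∈ w₁, x.1 < k := fun x hx =>
    lt_of_le_of_ne (hmax x (by simp [hx])) (h1 x hx)
  have h3' : ∀ x ∈ w₂.head?, x.1 < k := fun x hx =>
    lt_of_le_of_ne (hmax x (by simp [List.mem_of_mem_head? hx])) (h3 x hx)
  have hgp := isPolyAt_word (incl := incl) (X := X) g hg h2
  have hlen : 0 < g.length := List.length_pos_iff.mpr hg
  set c := E (word incl X g) with hc
  -- replace the maximal run, in an arbitrary context
  have step : ∀ {o o' : Option ℕ} {a a' : A}, WordEnding incl X o a → (∀ i ∈ o, i < k) →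
      WordStarting incl X o' a' → (∀ i ∈ o', i < k) →
      E (a * (word incl X (w₁ ++ (g ++ w₂)) * a')) =
        E (a * (word incl X w₁ * incl c * word incl X w₂ * a')) := by
    intro o o' a a' ha ho ha' ho'
    obtain ⟨p, hp, hpk⟩ := ha.mul_word ho w₁ h1'
    obtain ⟨p', hp', hpk'⟩ := ha'.word_mul ho' w₂ h3'
    have := h.peak hp hpk hgp hp' hpk'
    simpa [mul_assoc] using this
  have e1 := step ha (fun i hi => (ho i hi).trans_le hsk) ha' (fun i hi => (ho' i hi).trans_le hsk)
  -- With empty context the same replacement applies to the inner expectation, so both sides now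
  -- involve the same shorter word.
  have e2 : E (word incl X (w₁ ++ (g ++ w₂))) =
      E (word incl X w₁ * incl c * word incl X w₂) := by
    have := step (o := none) (o' := none) (WordEnding.const 1) (by simp)
      (WordStarting.const 1) (by simp)
    simpa using this
  rw [e1, e2]
  -- The coefficient `c` joins the last letter of `w₁`, or the left context `a` when `w₁` is empty.
  by_cases hw1 : w₁ = []
  · subst hw1
    have := ih w₂.length (by simp at hn; omega) (ha.mul_incl c) ho w₂
      (fun x hx => hw x (by simp [hx])) rfl
    simp only [word_nil, one_mul, E.map_incl_mul, map_mul]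
    simpa [mul_assoc] using this
  · obtain ⟨w', hw', e⟩ := exists_word_mul_incl (incl := incl) X w₁ hw1 c
    rw [e, ← word_append]
    refine ih (w' ++ w₂).length ?_ ha ho _ ?_ rfl
    · have : w'.length = w₁.length := by simpa using congrArg List.length hw'
      simp at hn ⊢
      omega
    · intro x hx
      rw [List.mem_append] at hx
      rcases hx with hx | hx
      · have : x.1 ∈ w₁.map Prod.fst := hw' ▸ List.mem_map_of_mem hx
        obtain ⟨y, hy, hyx⟩ := List.mem_map.mp this
        exact hyx ▸ hw y (by simp [hy])
      · exact hw x (by simp [hx])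

end Words

/-- Sorts the words in `x` and `y` by the position of the first `x`. -/
theorem add_pow_eq_sum_antidiagonal {R : Type*} [Ring R] (x y : R) (n : ℕ) :
    (x + y) ^ (n + 1) = y ^ (n + 1) +
      ∑ p ∈ antidiagonal n, y ^ p.1 * (x * (x + y) ^ p.2) := by
  induction n with
  | zero => simp [add_comm]
  | succ n ih =>
    have h : (x + y) ^ (n + 2) = x * (x + y) ^ (n + 1) + y * (x + y) ^ (n + 1) := by
      rw [pow_succ' (x + y) (n + 1), add_mul]
    have h2 : y * (x + y) ^ (n + 1) = y ^ (n + 2) +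
        ∑ p ∈ antidiagonal n, y ^ (p.1 + 1) * (x * (x + y) ^ p.2) := by
      rw [ih, mul_add, ← pow_succ', Finset.mul_sum]
      simp only [pow_succ' y, mul_assoc]
    rw [h, h2, Finset.Nat.antidiagonal_succ, Finset.sum_cons, Finset.sum_map, add_left_comm]
    simp

/-! ### Decoupling for linear combinations of words. -/

section Spans

variable {B : Type*} [CStarAlgebra B] [PartialOrder B] [StarOrderedRing B]
  {A : Type*} [CStarAlgebra A] {incl : B →⋆ₐ[ℂ] A}

variable (incl) in
/-- The span of the words whose last letter, if any, has index less than `s`. -/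
def endingSpan (X : ℕ → A) (s : ℕ) : Submodule ℂ A :=
  Submodule.span ℂ {a | ∃ o, WordEnding incl X o a ∧ ∀ i ∈ o, i < s}

variable (incl) in
/-- The span of the words whose first letter, if any, has index less than `s`. -/
def startingSpan (X : ℕ → A) (s : ℕ) : Submodule ℂ A :=
  Submodule.span ℂ {a | ∃ o, WordStarting incl X o a ∧ ∀ i ∈ o, i < s}

variable (incl) in
/-- The span of the words all of whose letters have index at least `s`. -/
def wordSpan (X : ℕ → A) (s : ℕ) : Submodule ℂ A :=
  Submodule.span ℂ {a | ∃ w, (∀ x ∈ w, s ≤ x.1) ∧ a = word incl X w}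

theorem MonotoneIndep.decouple {E : CondExp incl} {X : ℕ → A} (h : MonotoneIndep E X) {s : ℕ}
    {a u a' : A} (ha : a ∈ endingSpan incl X s) (hu : u ∈ wordSpan incl X s)
    (ha' : a' ∈ startingSpan incl X s) : E (a * (u * a')) = E (a * (incl (E u) * a')) := by
  induction ha using Submodule.span_induction with
  | zero => simp
  | add x y _ _ hx hy => rw [add_mul, add_mul, map_add, map_add, hx, hy]
  | smul z x _ hx => rw [smul_mul_assoc, smul_mul_assoc, map_smul, map_smul, hx]
  | mem a ha =>
  obtain ⟨o, ha, ho⟩ := ha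
  induction ha' using Submodule.span_induction with
  | zero => simp
  | add x y _ _ hx hy =>
    rw [mul_add, mul_add, map_add, hx, hy, mul_add, mul_add, map_add]
  | smul z x _ hx =>
    rw [mul_smul_comm, mul_smul_comm, map_smul, hx, mul_smul_comm, mul_smul_comm, map_smul]
  | mem a' ha' =>
  obtain ⟨o', ha', ho'⟩ := ha'
  induction hu using Submodule.span_induction with
  | zero => simp
  | add x y _ _ hx hy =>
    rw [add_mul, mul_add, map_add, hx, hy, map_add, map_add, add_mul, mul_add, map_add]
  | smul z x _ hx =>
    rw [smul_mul_assoc, mul_smul_comm, map_smul, hx, map_smul, map_smul, smul_mul_assoc,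
      mul_smul_comm, map_smul]
  | mem u hu =>
  obtain ⟨w, hw, rfl⟩ := hu
  exact h.decouple_word ha ho ha' ho' w hw

theorem one_mem_wordSpan (X : ℕ → A) (s : ℕ) : (1 : A) ∈ wordSpan incl X s :=
  Submodule.subset_span ⟨[], by simp, rfl⟩

theorem mul_letter_mem_wordSpan {X : ℕ → A} {s i : ℕ} (hi : s ≤ i) {u : A}
    (hu : u ∈ wordSpan incl X s) (b : B) : u * (X i * incl b) ∈ wordSpan incl X s := by
  induction hu using Submodule.span_induction with
  | zero => simp
  | add x y _ _ hx hy => rw [add_mul]; exact add_mem hx hy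
  | smul z x _ hx => rw [smul_mul_assoc]; exact Submodule.smul_mem _ _ hx
  | mem u hu =>
    obtain ⟨w, hw, rfl⟩ := hu
    refine Submodule.subset_span ⟨w ++ [(i, b)], ?_, by simp⟩
    intro x hx
    rw [List.mem_append, List.mem_singleton] at hx
    rcases hx with hx | rfl
    exacts [hw x hx, hi]

theorem WordEnding.exists_mul_word {X : ℕ → A} {o : Option ℕ} {a : A}
    (ha : WordEnding incl X o a) (w : List (ℕ × B)) :
    ∃ o', WordEnding incl X o' (a * word incl X w) := by
  induction w generalizing o a with
  | nil => exact ⟨o, by simpa using ha⟩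
  | cons x w ih =>
    rw [word_cons, ← mul_assoc]
    exact ih (.snoc ha x.1 x.2)

/-- Only the last letter is constrained, so the indices occurring in `u` are irrelevant and `t` is
unrelated to `s`. -/
theorem mul_letter_mem_endingSpan {X : ℕ → A} {s t i : ℕ} (hi : i < s) {a u : A}
    (ha : a ∈ endingSpan incl X s) (hu : u ∈ wordSpan incl X t) (b : B) :
    a * u * (X i * incl b) ∈ endingSpan incl X s := by
  induction ha using Submodule.span_induction with
  | zero => simp
  | add x y _ _ hx hy => rw [add_mul, add_mul]; exact add_mem hx hy
  | smul z x _ hx => rw [smul_mul_assoc, smul_mul_assoc]; exact Submodule.smul_mem _ _ hx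
  | mem a ha =>
  obtain ⟨o, ha, -⟩ := ha
  induction hu using Submodule.span_induction with
  | zero => simp
  | add x y _ _ hx hy => rw [mul_add, add_mul]; exact add_mem hx hy
  | smul z x _ hx => rw [mul_smul_comm, smul_mul_assoc]; exact Submodule.smul_mem _ _ hx
  | mem u hu =>
  obtain ⟨w, -, rfl⟩ := hu
  obtain ⟨o', h⟩ := ha.exists_mul_word w
  exact Submodule.subset_span ⟨some i, h.snoc i b, by simpa using hi⟩

theorem one_mem_endingSpan (X : ℕ → A) (s : ℕ) : (1 : A) ∈ endingSpan incl X s :=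
  Submodule.subset_span ⟨none, by simpa using WordEnding.const (incl := incl) (X := X) 1, by simp⟩

theorem one_mem_startingSpan (X : ℕ → A) (s : ℕ) : (1 : A) ∈ startingSpan incl X s :=
  Submodule.subset_span
    ⟨none, by simpa using WordStarting.const (incl := incl) (X := X) 1, by simp⟩

theorem letter_mul_mem_startingSpan {X : ℕ → A} {s i : ℕ} (hi : i < s) {a : A}
    (ha : a ∈ startingSpan incl X s) (b : B) : X i * incl b * a ∈ startingSpan incl X s := by
  induction ha using Submodule.span_induction with
  | zero => simp
  | add x y _ _ hx hy => rw [mul_add]; exact add_mem hx hy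
  | smul z x _ hx => rw [mul_smul_comm]; exact Submodule.smul_mem _ _ hx
  | mem a ha =>
    obtain ⟨o, ha, -⟩ := ha
    refine Submodule.subset_span ⟨some i, ?_, by simpa using hi⟩
    simpa [mul_assoc] using (ha.incl_mul b).cons i 1

end Spans

/-! ### Matrix moments and the recursion for partial sums. -/

section Matrices

variable {B : Type*} [CStarAlgebra B] [PartialOrder B] [StarOrderedRing B]
  {A : Type*} [CStarAlgebra A] {incl : B →⋆ₐ[ℂ] A} {m : ℕ}

variable (incl) in
/-- The matrix `(x ⊗ 1_m) b`. -/
def lmulMatrix (x : A) (b : Matrix (Fin m) (Fin m) B) : Matrix (Fin m) (Fin m) A :=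
  Matrix.of fun i j => x * incl (b i j)

theorem lmulMatrix_add (x y : A) (b : Matrix (Fin m) (Fin m) B) :
    lmulMatrix incl (x + y) b = lmulMatrix incl x b + lmulMatrix incl y b := by
  ext i j
  simp [lmulMatrix, add_mul]

theorem lmulMatrix_mul_map (x : A) (b c : Matrix (Fin m) (Fin m) B) :
    lmulMatrix incl x b * c.map incl = lmulMatrix incl x (b * c) := by
  ext i j
  simp [lmulMatrix, Matrix.mul_apply, Finset.mul_sum, mul_assoc]

theorem CondExp.map_matrix_incl_mul (E : CondExp incl) (b : Matrix (Fin m) (Fin m) B)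
    (M : Matrix (Fin m) (Fin m) A) : (b.map incl * M).map E = b * M.map E := by
  ext i j
  simp [Matrix.mul_apply, E.map_incl_mul]

theorem CondExp.map_matrix_one (E : CondExp incl) :
    (1 : Matrix (Fin m) (Fin m) A).map E = 1 :=
  Matrix.map_one _ (map_zero _) E.map_one

theorem CondExp.map_matrix_sum (E : CondExp incl) {ι : Type*} (s : Finset ι)
    (M : ι → Matrix (Fin m) (Fin m) A) : (∑ i ∈ s, M i).map E = ∑ i ∈ s, (M i).map E := by
  ext i j
  simp [Matrix.sum_apply]

theorem CondExp.map_matrix_add (E : CondExp incl) (M N : Matrix (Fin m) (Fin m) A) :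
    (M + N).map E = M.map E + N.map E := by
  ext i j
  simp

/-- The moments `(E ⊗ 1_m)([x b]^n)`. -/
def matrixMoment (E : CondExp incl) (x : A) (b : Matrix (Fin m) (Fin m) B) (n : ℕ) :
    Matrix (Fin m) (Fin m) B :=
  (lmulMatrix incl x b ^ n).map E

variable (incl) in
/-- The homogeneous components of `(1 - x c)⁻¹`, where `c i` has degree `i + 1`. -/
def resolventCoeff (x : A) (c : ℕ → Matrix (Fin m) (Fin m) B) : ℕ → Matrix (Fin m) (Fin m) A
  | 0 => 1
  | n + 1 => ∑ p ∈ (antidiagonal n).attach,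
      lmulMatrix incl x (c p.1.1) * resolventCoeff x c p.1.2
decreasing_by
  have := mem_antidiagonal.mp p.2
  omega

theorem resolventCoeff_zero (x : A) (c : ℕ → Matrix (Fin m) (Fin m) B) :
    resolventCoeff incl x c 0 = 1 := by
  rw [resolventCoeff]

theorem resolventCoeff_succ (x : A) (c : ℕ → Matrix (Fin m) (Fin m) B) (n : ℕ) :
    resolventCoeff incl x c (n + 1) = ∑ p ∈ antidiagonal n,
      lmulMatrix incl x (c p.1) * resolventCoeff incl x c p.2 := by
  rw [resolventCoeff]
  exact Finset.sum_attach _ fun p : ℕ × ℕ =>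
    lmulMatrix incl x (c p.1) * resolventCoeff incl x c p.2

theorem resolventCoeff_mem (X : ℕ → A) (s : ℕ) (c : ℕ → Matrix (Fin m) (Fin m) B) (n : ℕ)
    (i j : Fin m) : resolventCoeff incl (X s) c n i j ∈ startingSpan incl X (s + 1) := by
  induction n using Nat.strong_induction_on generalizing i j with
  | _ n ih =>
  cases n with
  | zero =>
    rw [resolventCoeff_zero, Matrix.one_apply]
    split_ifs
    exacts [one_mem_startingSpan X _, zero_mem _]
  | succ n =>
    rw [resolventCoeff_succ, Matrix.sum_apply]
    refine sum_mem fun p hp => ?_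
    rw [Matrix.mul_apply]
    refine sum_mem fun k _ => ?_
    have := mem_antidiagonal.mp hp
    exact letter_mul_mem_startingSpan (Nat.lt_succ_self s) (ih p.2 (by omega) k j) _

theorem lmulMatrix_sum_pow_mem (X : ℕ → A) (s : ℕ) (t : Finset ℕ) (ht : ∀ i ∈ t, s ≤ i)
    (b : Matrix (Fin m) (Fin m) B) (n : ℕ) (i j : Fin m) :
    (lmulMatrix incl (∑ k ∈ t, X k) b ^ n) i j ∈ wordSpan incl X s := by
  induction n generalizing i j with
  | zero =>
    rw [pow_zero, Matrix.one_apply]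
    split_ifs
    exacts [one_mem_wordSpan X _, zero_mem _]
  | succ n ih =>
    rw [pow_succ, Matrix.mul_apply]
    refine sum_mem fun k _ => ?_
    rw [show lmulMatrix incl (∑ k ∈ t, X k) b k j = ∑ l ∈ t, X l * incl (b k j) from
      Finset.sum_mul _ _ _, Finset.mul_sum]
    exact sum_mem fun l hl => mul_letter_mem_wordSpan (ht l hl) (ih i k) _

theorem MonotoneIndep.decouple_matrix {E : CondExp incl} {X : ℕ → A} (h : MonotoneIndep E X)
    {s : ℕ} {L U R : Matrix (Fin m) (Fin m) A} (hL : ∀ i j, L i j ∈ endingSpan incl X s)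
    (hU : ∀ i j, U i j ∈ wordSpan incl X s) (hR : ∀ i j, R i j ∈ startingSpan incl X s) :
    (L * (U * R)).map E = (L * ((U.map E).map incl * R)).map E := by
  ext i j
  simp only [Matrix.map_apply, Matrix.mul_apply, Finset.mul_sum, map_sum]
  exact Finset.sum_congr rfl fun k _ => Finset.sum_congr rfl fun l _ =>
    h.decouple (hL i k) (hU k l) (hR l j)

/-- Each word is cut at its first `X s`. The tail after it is rewritten by induction, and only then
is the block of later variables before it decoupled, since its right context now lies in the
starting span. The left factor `L` is general because the induction hypothesis is used behind a
nontrivial prefix. -/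
theorem MonotoneIndep.expand {E : CondExp incl} {X : ℕ → A} (h : MonotoneIndep E X)
    (s : ℕ) (t : Finset ℕ) (ht : ∀ i ∈ t, s + 1 ≤ i) (b : Matrix (Fin m) (Fin m) B) (n : ℕ)
    {L : Matrix (Fin m) (Fin m) A} (hL : ∀ i j, L i j ∈ endingSpan incl X (s + 1)) :
    (L * lmulMatrix incl (X s + ∑ k ∈ t, X k) b ^ n).map E =
      (L * ∑ p ∈ antidiagonal n, (matrixMoment E (∑ k ∈ t, X k) b p.1).map incl *
        resolventCoeff incl (X s) (fun i => b * matrixMoment E (∑ k ∈ t, X k) b i) p.2).map E := by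
  set Y := ∑ k ∈ t, X k with hY
  set R := resolventCoeff incl (X s) (fun i => b * matrixMoment E Y b i) with hR
  have hU : ∀ n i j, (lmulMatrix incl Y b ^ n) i j ∈ wordSpan incl X (s + 1) :=
    fun n i j => lmulMatrix_sum_pow_mem X (s + 1) t ht b n i j
  have hRm : ∀ n i j, R n i j ∈ startingSpan incl X (s + 1) :=
    fun n i j => resolventCoeff_mem X s _ n i j
  have hR0 : R 0 = 1 := resolventCoeff_zero _ _
  induction n using Nat.strong_induction_on generalizing L with
  | _ n ih =>
  cases n with
  | zero =>
    have e : (matrixMoment E Y b 0).map incl = 1 := by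
      rw [matrixMoment, pow_zero, E.map_matrix_one,
        Matrix.map_one _ (map_zero _) (_root_.map_one _)]
    simp [hR0, e]
  | succ n =>
    have h1 : (L * lmulMatrix incl Y b ^ (n + 1)).map E =
        (L * ((matrixMoment E Y b (n + 1)).map incl * R 0)).map E := by
      have := h.decouple_matrix hL (hU (n + 1)) (hRm 0)
      simpa [hR0, matrixMoment] using this
    have h2 : ∀ p ∈ antidiagonal n,
        (L * (lmulMatrix incl Y b ^ p.1 * (lmulMatrix incl (X s) b *
          lmulMatrix incl (X s + Y) b ^ p.2))).map E =
        (L * ((matrixMoment E Y b p.1).map incl * R (p.2 + 1))).map E := by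
      intro p hp
      have hp := mem_antidiagonal.mp hp
      have hL' : ∀ i j, (L * lmulMatrix incl Y b ^ p.1 * lmulMatrix incl (X s) b) i j ∈
          endingSpan incl X (s + 1) := by
        intro i j
        rw [Matrix.mul_apply]
        refine sum_mem fun k _ => ?_
        rw [Matrix.mul_apply, Finset.sum_mul]
        exact sum_mem fun l _ =>
          mul_letter_mem_endingSpan (Nat.lt_succ_self s) (hL i l) (hU p.1 l k) _
      -- The letter `X s` times the rewritten tail is the recursive definition of the next resolvent
      -- coefficient.
      have e : lmulMatrix incl (X s) b * ∑ q ∈ antidiagonal p.2,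
          (matrixMoment E Y b q.1).map incl * R q.2 = R (p.2 + 1) := by
        rw [hR, resolventCoeff_succ, Finset.mul_sum]
        refine Finset.sum_congr rfl fun q _ => ?_
        rw [← Matrix.mul_assoc, lmulMatrix_mul_map]
      have := ih p.2 (by omega) hL'
      rw [Matrix.mul_assoc _ _ (∑ q ∈ _, _), e] at this
      simp only [← Matrix.mul_assoc] at this ⊢
      rw [this]
      simp only [Matrix.mul_assoc]
      exact h.decouple_matrix hL (hU p.1) (hRm _)
    rw [lmulMatrix_add, add_pow_eq_sum_antidiagonal, ← lmulMatrix_add, Matrix.mul_add,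
      E.map_matrix_add, h1, Finset.mul_sum, E.map_matrix_sum, Finset.sum_congr rfl h2,
      Finset.Nat.antidiagonal_succ', Finset.sum_cons, Finset.sum_map, Matrix.mul_add,
      E.map_matrix_add, Finset.mul_sum, E.map_matrix_sum]
    rfl

/-- Splitting off the variable with the lowest index. -/
theorem MonotoneIndep.matrixMoment_add {E : CondExp incl} {X : ℕ → A} (h : MonotoneIndep E X)
    (s : ℕ) (t : Finset ℕ) (ht : ∀ i ∈ t, s + 1 ≤ i) (b : Matrix (Fin m) (Fin m) B) (n : ℕ) :
    matrixMoment E (X s + ∑ k ∈ t, X k) b n =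
      ∑ p ∈ antidiagonal n, matrixMoment E (∑ k ∈ t, X k) b p.1 *
        (resolventCoeff incl (X s)
          (fun i => b * matrixMoment E (∑ k ∈ t, X k) b i) p.2).map E := by
  have := h.expand s t ht b n (L := 1) (fun i j => by
    rw [Matrix.one_apply]
    split_ifs
    exacts [one_mem_endingSpan X _, zero_mem _])
  rw [Matrix.one_mul, Matrix.one_mul, E.map_matrix_sum] at this
  simp only [E.map_matrix_incl_mul] at this
  exact this

/-- The entries are values at `x` of polynomials that do not depend on `x`, so their expectations
depend only on the law. -/
theorem resolventCoeff_law {E : CondExp incl} {x y : A}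
    (hxy : ∀ p : NCPoly B, E (NCPoly.eval incl x p) = E (NCPoly.eval incl y p))
    (c : ℕ → Matrix (Fin m) (Fin m) B) (n : ℕ) :
    (resolventCoeff incl x c n).map E = (resolventCoeff incl y c n).map E := by
  have key : ∃ P : Matrix (Fin m) (Fin m) (NCPoly B), ∀ z : A,
      resolventCoeff incl z c n = P.map (NCPoly.eval incl z) := by
    induction n using Nat.strong_induction_on with
    | _ n ih =>
    cases n with
    | zero =>
      exact ⟨1, fun z => by
        rw [resolventCoeff_zero, Matrix.map_one _ (map_zero _) (map_one _)]⟩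
    | succ n =>
      choose! P hP using ih
      refine ⟨∑ p ∈ antidiagonal n,
        (Matrix.of fun i j => NCPoly.X B * NCPoly.C B (c p.1 i j)) * P p.2, fun z => ?_⟩
      rw [resolventCoeff_succ]
      ext i j
      rw [Matrix.map_apply, Matrix.sum_apply, Matrix.sum_apply, map_sum]
      refine Finset.sum_congr rfl fun p hp => ?_
      have hp := mem_antidiagonal.mp hp
      rw [hP p.2 (by omega), Matrix.mul_apply, Matrix.mul_apply, map_sum]
      simp [lmulMatrix, NCPoly.eval_X, NCPoly.eval_C]
  obtain ⟨P, hP⟩ := key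
  ext i j
  simp only [hP, Matrix.map_apply, hxy]

/-- The moments of partial sums of a monotone independent identically distributed sequence. -/
theorem MonotoneIndep.matrixMoment_sum_succ {E : CondExp incl} {X : ℕ → A}
    (h : MonotoneIndep E X)
    (hid : ∀ i k, ∀ p : NCPoly B, E (NCPoly.eval incl (X i) p) = E (NCPoly.eval incl (X k) p))
    (b : Matrix (Fin m) (Fin m) B) (N n : ℕ) :
    matrixMoment E (∑ i ∈ Finset.range (N + 1), X i) b n =
      ∑ p ∈ antidiagonal n, matrixMoment E (∑ i ∈ Finset.range N, X i) b p.1 *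
        (resolventCoeff incl (X 0)
          (fun i => b * matrixMoment E (∑ i ∈ Finset.range N, X i) b i) p.2).map E := by
  have step : ∀ N s n, matrixMoment E (∑ i ∈ Finset.Ico s (s + (N + 1)), X i) b n =
      ∑ p ∈ antidiagonal n,
        matrixMoment E (∑ i ∈ Finset.Ico (s + 1) (s + 1 + N), X i) b p.1 *
        (resolventCoeff incl (X 0) (fun i => b *
          matrixMoment E (∑ i ∈ Finset.Ico (s + 1) (s + 1 + N), X i) b i) p.2).map E := by
    intro N s n
    rw [Finset.sum_eq_sum_Ico_succ_bot (by omega), show s + (N + 1) = s + 1 + N by omega,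
      h.matrixMoment_add s _ (by simp; omega)]
    exact Finset.sum_congr rfl fun p _ => by rw [resolventCoeff_law (hid s 0)]
  -- Removing the lowest variable shifts the window of indices by one; by induction the moments
  -- depend only on the length of the window.
  have shift : ∀ N s, matrixMoment E (∑ i ∈ Finset.Ico s (s + N), X i) b =
      matrixMoment E (∑ i ∈ Finset.range N, X i) b := by
    intro N
    induction N with
    | zero => simp
    | succ N ih =>
      intro s
      funext n
      have h0 := step N 0 n
      rw [ih] at h0
      rw [step, ih, ← h0, zero_add, Finset.range_eq_Ico]
  have h0 := step N 0 n
  rwa [shift N (0 + 1), zero_add, ← Finset.range_eq_Ico] at h0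

end Matrices

/-! ### The limit of the moments -/

/-- The expression equals N((1 + 1/N)^{(n+2)/2} - 1), a difference quotient at 0 with increment 1/N.
-/
theorem tendsto_sqrt_pow_sub (n : ℕ) :
    Tendsto (fun N : ℕ => (√(N : ℝ))⁻¹ ^ n * (√((N : ℝ) + 1) ^ (n + 2) - √(N : ℝ) ^ (n + 2)))
      atTop (𝓝 (((n : ℝ) + 2) / 2)) := by
  have hd : HasDerivAt (fun t : ℝ => √(1 + t) ^ (n + 2)) (((n : ℝ) + 2) / 2) 0 := by
    have h1 : HasDerivAt (fun t : ℝ => 1 + t) 1 0 := (hasDerivAt_id (0 : ℝ)).const_add 1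
    have h2 := (h1.sqrt (by norm_num)).pow (n + 2)
    refine h2.congr_deriv ?_
    simp
    ring
  have hs := hasDerivAt_iff_tendsto_slope_zero.mp hd
  have ht : Tendsto (fun N : ℕ => ((N : ℝ))⁻¹) atTop (𝓝[≠] 0) := by
    refine tendsto_nhdsWithin_iff.mpr ⟨tendsto_inv_atTop_nhds_zero_nat, ?_⟩
    filter_upwards [eventually_gt_atTop 0] with N hN
    simpa using hN.ne'
  refine (hs.comp ht).congr' ?_
  filter_upwards [eventually_gt_atTop 0] with N hN
  have hN' : (0 : ℝ) < N := by exact_mod_cast hN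
  have hsq : 0 < √(N : ℝ) := Real.sqrt_pos.mpr hN'
  have e : √((N : ℝ) + 1) = √(N : ℝ) * √(1 + (N : ℝ)⁻¹) := by
    rw [← Real.sqrt_mul hN'.le]
    congr 1
    field_simp
  have e2 : √(N : ℝ) ^ (n + 2) = √(N : ℝ) ^ n * N := by
    rw [pow_add, Real.sq_sqrt hN'.le]
  simp only [Function.comp_apply, zero_add, add_zero, inv_inv, smul_eq_mul, Real.sqrt_one, one_pow]
  rw [e, mul_pow, e2]
  have h1 : (√(N : ℝ))⁻¹ ^ n * √(N : ℝ) ^ n = 1 := by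
    rw [← mul_pow, inv_mul_cancel₀ hsq.ne', one_pow]
  linear_combination -((N : ℝ) * (√(1 + (N : ℝ)⁻¹) ^ (n + 2) - 1)) * h1

/-- A Stolz–Cesàro theorem at the scale of half-integer powers. -/
theorem tendsto_of_tendsto_sub {V : Type*} [NormedAddCommGroup V] [NormedSpace ℝ V] (n : ℕ)
    (f : ℕ → V) (c : V)
    (h : Tendsto (fun N : ℕ => (√(N : ℝ))⁻¹ ^ n • (f (N + 1) - f N)) atTop (𝓝 c)) :
    Tendsto (fun N : ℕ => (√(N : ℝ))⁻¹ ^ (n + 2) • f N) atTop (𝓝 ((2 / ((n : ℝ) + 2)) • c)) := by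
  -- The expected limit `d` is chosen so that `f` is compared with √N^{n+2} • d; the `g N` are the
  -- increments of √N^{n+2}.
  set d := (2 / ((n : ℝ) + 2)) • c with hd
  set g : ℕ → ℝ := fun N => √((N : ℝ) + 1) ^ (n + 2) - √(N : ℝ) ^ (n + 2) with hg
  have hpos : ∀ᶠ N : ℕ in atTop, 0 < √(N : ℝ) := by
    filter_upwards [eventually_gt_atTop 0] with N hN
    exact Real.sqrt_pos.mpr (by exact_mod_cast hN)
  have hg0 : ∀ N, 0 ≤ g N := fun N =>
    sub_nonneg.mpr (pow_le_pow_left₀ (Real.sqrt_nonneg _) (Real.sqrt_le_sqrt (by linarith)) _)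
  have hsum : ∀ N, ∑ i ∈ Finset.range N, g i = √(N : ℝ) ^ (n + 2) := by
    intro N
    have := Finset.sum_range_sub (fun N : ℕ => √(N : ℝ) ^ (n + 2)) N
    simpa [hg] using this
  have hsqrt : Tendsto (fun N : ℕ => √(N : ℝ)) atTop atTop :=
    Real.tendsto_sqrt_atTop.comp tendsto_natCast_atTop_atTop
  have hgt : Tendsto (fun N => ∑ i ∈ Finset.range N, g i) atTop atTop := by
    simp only [hsum]
    exact (tendsto_pow_atTop (by omega)).comp hsqrt
  have hlim := tendsto_sqrt_pow_sub n
  have hw : Tendsto (fun N : ℕ => (√(N : ℝ))⁻¹ ^ n • (f (N + 1) - f N - g N • d)) atTop (𝓝 0) := by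
    have h1 := h.sub (hlim.smul_const d)
    have e : c - (((n : ℝ) + 2) / 2) • d = 0 := by
      rw [hd, smul_smul]
      have : ((n : ℝ) + 2) / 2 * (2 / ((n : ℝ) + 2)) = 1 := by
        have : (n : ℝ) + 2 ≠ 0 := by positivity
        field_simp
      rw [this, one_smul, sub_self]
    rw [e] at h1
    refine h1.congr fun N => ?_
    rw [smul_sub _ (f (N + 1) - f N), smul_smul _ (g N) d]
  have hO : (fun N : ℕ => √(N : ℝ) ^ n) =O[atTop] g := by
    have hev : ∀ᶠ N : ℕ in atTop, (1 / 2 : ℝ) < (√(N : ℝ))⁻¹ ^ n * g N :=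
      hlim.eventually (lt_mem_nhds (by
        have : (0 : ℝ) ≤ n := by positivity
        linarith))
    refine Asymptotics.IsBigO.of_bound 2 ?_
    filter_upwards [hev, hpos] with N h1 h2
    rw [Real.norm_of_nonneg (by positivity), Real.norm_of_nonneg (hg0 N)]
    have h3 : 0 < √(N : ℝ) ^ n := by positivity
    rw [inv_pow, inv_mul_eq_div, lt_div_iff₀ h3] at h1
    linarith
  have ho : (fun N : ℕ => f (N + 1) - f N - g N • d) =o[atTop] g := by
    refine Asymptotics.IsLittleO.trans_isBigO ?_ hO
    have h1 : (fun N : ℕ => √(N : ℝ) ^ n • ((√(N : ℝ))⁻¹ ^ n • (f (N + 1) - f N - g N • d)))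
        =o[atTop] fun N : ℕ => √(N : ℝ) ^ n • (1 : ℝ) :=
      (Asymptotics.isBigO_refl _ _).smul_isLittleO ((Asymptotics.isLittleO_one_iff ℝ).mpr hw)
    refine h1.congr' ?_ (by simp)
    filter_upwards [hpos] with N hN
    rw [smul_smul, ← mul_pow, mul_inv_cancel₀ hN.ne', one_pow, one_smul]
  -- Since the nonnegative weights `g` have divergent sum, the little-o estimate for increments
  -- passes to partial sums, which telescope.
  have hs := ho.sum_range hg0 hgt
  have hfs : ∀ N, ∑ i ∈ Finset.range N, (f (i + 1) - f i - g i • d) =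
      f N - f 0 - √(N : ℝ) ^ (n + 2) • d := fun N => by
    rw [Finset.sum_sub_distrib, Finset.sum_range_sub, ← Finset.sum_smul, hsum]
  simp only [hfs, hsum] at hs
  have h2 : Tendsto (fun N : ℕ => (√(N : ℝ))⁻¹ ^ (n + 2) •
      (f N - f 0 - √(N : ℝ) ^ (n + 2) • d)) atTop (𝓝 0) := by
    have h3 := (Asymptotics.isBigO_refl (fun N : ℕ => (√(N : ℝ))⁻¹ ^ (n + 2)) atTop).smul_isLittleO hs
    rw [← Asymptotics.isLittleO_one_iff ℝ]
    refine h3.trans_isBigO (Asymptotics.IsBigO.of_bound 1 ?_)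
    filter_upwards [hpos] with N hN
    rw [smul_eq_mul, ← mul_pow, inv_mul_cancel₀ hN.ne']
    simp
  have h4 : Tendsto (fun N : ℕ => (√(N : ℝ))⁻¹ ^ (n + 2) • f 0) atTop (𝓝 0) := by
    have : Tendsto (fun N : ℕ => (√(N : ℝ))⁻¹ ^ (n + 2)) atTop (𝓝 0) := by
      simpa using (tendsto_inv_atTop_zero.comp hsqrt).pow (n + 2)
    simpa using this.smul_const (f 0)
  have h5 := (h2.add h4).add_const d
  rw [add_zero, zero_add] at h5
  refine h5.congr' ?_
  filter_upwards [hpos] with N hN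
  rw [smul_sub, smul_sub, smul_smul, ← mul_pow, inv_mul_cancel₀ hN.ne', one_pow, one_smul]
  abel

section Limit

variable {B : Type*} [CStarAlgebra B] [PartialOrder B] [StarOrderedRing B]
  {A : Type*} [CStarAlgebra A] {incl : B →⋆ₐ[ℂ] A} {m : ℕ}

theorem incl_continuous (incl : B →⋆ₐ[ℂ] A) : Continuous incl :=
  AddMonoidHomClass.continuous_of_bound incl 1 fun b => by
    simpa using NonUnitalStarAlgHom.norm_apply_le incl b

theorem lmulMatrix_smul (x : A) (r : ℝ) (b : Matrix (Fin m) (Fin m) B) :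
    lmulMatrix incl x (r • b) = r • lmulMatrix incl x b := by
  ext i j
  have : incl (r • b i j) = r • incl (b i j) :=
    map_real_smul incl (incl_continuous incl) _ _
  simp [lmulMatrix, this]

theorem tendsto_lmulMatrix {ι : Type*} {l : Filter ι} (x : A) {f : ι → Matrix (Fin m) (Fin m) B}
    {b : Matrix (Fin m) (Fin m) B} (h : Tendsto f l (𝓝 b)) :
    Tendsto (fun t => lmulMatrix incl x (f t)) l (𝓝 (lmulMatrix incl x b)) := by
  have : Continuous fun b : Matrix (Fin m) (Fin m) B => lmulMatrix incl x b := by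
    refine continuous_matrix fun i j => ?_
    exact continuous_const.mul ((incl_continuous incl).comp (continuous_id.matrix_elem i j))
  exact (this.tendsto b).comp h

theorem CondExp.tendsto_map_matrix (E : CondExp incl) {ι : Type*} {l : Filter ι}
    {f : ι → Matrix (Fin m) (Fin m) A} {M : Matrix (Fin m) (Fin m) A} (h : Tendsto f l (𝓝 M)) :
    Tendsto (fun t => (f t).map E) l (𝓝 (M.map E)) := by
  have : Continuous fun M : Matrix (Fin m) (Fin m) A => M.map E :=
    continuous_id.matrix_map E.continuous
  exact (this.tendsto M).comp h

theorem CondExp.map_matrix_smul (E : CondExp incl) (r : ℝ) (M : Matrix (Fin m) (Fin m) A) :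
    (r • M).map E = r • M.map E := by
  ext i j
  simp [LinearMap.map_smul_of_tower]

theorem CondExp.map_matrix_lmul {E : CondExp incl} {x : A} (hx : E x = 0)
    (c : Matrix (Fin m) (Fin m) B) : (lmulMatrix incl x c).map E = 0 := by
  ext i j
  simp [lmulMatrix, E.map_mul_incl, hx]

theorem CondExp.map_matrix_lmul_mul_lmul {E : CondExp incl} {x : A} {η : B → B}
    (hη : ∀ b, E (x * incl b * x) = η b) (c d : Matrix (Fin m) (Fin m) B) :
    (lmulMatrix incl x c * lmulMatrix incl x d).map E = c.map η * d := by
  ext i j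
  simp only [lmulMatrix, Matrix.map_apply, Matrix.mul_apply, Matrix.of_apply, map_sum]
  refine Finset.sum_congr rfl fun k _ => ?_
  rw [← hη, ← E.map_mul_incl]
  simp only [mul_assoc]

/-- Limit behaviour of the homogeneous components of the resolvent, when its argument is built
from rescaled sequences that converge. -/
theorem tendsto_resolventCoeff (x : A) (b : Matrix (Fin m) (Fin m) B)
    (a : ℕ → ℕ → Matrix (Fin m) (Fin m) B) (α : ℕ → Matrix (Fin m) (Fin m) B) (n : ℕ)
    (h : ∀ i ≤ n, Tendsto (fun N : ℕ => (√(N : ℝ))⁻¹ ^ i • a N i) atTop (𝓝 (α i))) :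
    Tendsto (fun N : ℕ => (√(N : ℝ))⁻¹ ^ n • resolventCoeff incl x (fun i => b * a N i) (n + 1))
      atTop (𝓝 (lmulMatrix incl x (b * α n))) := by
  have hq : Tendsto (fun N : ℕ => (√(N : ℝ))⁻¹) atTop (𝓝 0) :=
    tendsto_inv_atTop_zero.comp (Real.tendsto_sqrt_atTop.comp tendsto_natCast_atTop_atTop)
  induction n using Nat.strong_induction_on with
  | _ n ih =>
  -- For j ≥ 1 the coefficient of index j has order at most √N^{j-1}, so the scaling √N^{-j} kills
  -- it and only the pair (n, 0) contributes to the limit.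
  have hR : ∀ j ≤ n, Tendsto (fun N : ℕ => (√(N : ℝ))⁻¹ ^ j •
      resolventCoeff incl x (fun i => b * a N i) j) atTop (𝓝 (if j = 0 then 1 else 0)) := by
    intro j hj
    cases j with
    | zero => simp [resolventCoeff_zero]
    | succ j =>
      have := hq.smul (ih j (by omega) fun i hi => h i (by omega))
      simpa [smul_smul, pow_succ'] using this
  have key := tendsto_finsetSum (antidiagonal n) fun p hp =>
    (tendsto_lmulMatrix (incl := incl) x
      (tendsto_const_nhds (x := b).mul (h p.1 (antidiagonal.fst_le hp)))).mul
        (hR p.2 (antidiagonal.snd_le hp))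
  have e : ∑ p ∈ antidiagonal n, lmulMatrix incl x (b * α p.1) *
      (if p.2 = 0 then 1 else 0 : Matrix (Fin m) (Fin m) A) = lmulMatrix incl x (b * α n) := by
    rw [Finset.sum_eq_single (n, 0)]
    · simp
    · intro p hp hne
      have := mem_antidiagonal.mp hp
      have h2 : p.2 ≠ 0 := fun h0 => hne (Prod.ext (by simp; omega) h0)
      simp [h2]
    · simp
  rw [e] at key
  refine key.congr fun N => ?_
  rw [resolventCoeff_succ, Finset.smul_sum]
  refine Finset.sum_congr rfl fun p hp => ?_
  rw [← mem_antidiagonal.mp hp, pow_add, mul_comm ((√(N : ℝ))⁻¹ ^ p.1), mul_smul_comm,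
    mul_smul_comm, lmulMatrix_smul, smul_mul_assoc, smul_smul]

/-- The term with one `x` has expectation zero. The terms with two give `η` at order √N^n, and each
further `x` costs a power of √N. -/
theorem tendsto_map_resolventCoeff {E : CondExp incl} {x : A} (hx : E x = 0) {η : B → B}
    (hη : ∀ b, E (x * incl b * x) = η b) (b : Matrix (Fin m) (Fin m) B)
    (a : ℕ → ℕ → Matrix (Fin m) (Fin m) B) (α : ℕ → Matrix (Fin m) (Fin m) B) (n : ℕ)
    (h : ∀ i ≤ n, Tendsto (fun N : ℕ => (√(N : ℝ))⁻¹ ^ i • a N i) atTop (𝓝 (α i))) :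
    Tendsto (fun N : ℕ => (√(N : ℝ))⁻¹ ^ n •
        (resolventCoeff incl x (fun i => b * a N i) (n + 2)).map E)
      atTop (𝓝 (∑ p ∈ antidiagonal n, (b * α p.1).map η * (b * α p.2))) := by
  have key := tendsto_finsetSum (antidiagonal n) fun p hp =>
    E.tendsto_map_matrix ((tendsto_lmulMatrix (incl := incl) x
      (tendsto_const_nhds (x := b).mul (h p.1 (antidiagonal.fst_le hp)))).mul
        (tendsto_resolventCoeff (incl := incl) x b a α p.2 fun i hi =>
          h i (hi.trans (antidiagonal.snd_le hp))))
  simp only [E.map_matrix_lmul_mul_lmul hη] at key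
  refine key.congr fun N => ?_
  rw [resolventCoeff_succ, Finset.Nat.antidiagonal_succ', Finset.sum_cons, Finset.sum_map,
    resolventCoeff_zero, mul_one, E.map_matrix_add, E.map_matrix_lmul hx, zero_add,
    E.map_matrix_sum, Finset.smul_sum]
  refine Finset.sum_congr rfl fun p hp => ?_
  rw [← E.map_matrix_smul]
  congr 1
  change _ = (√(N : ℝ))⁻¹ ^ n • (lmulMatrix incl x (b * a N p.1) *
    resolventCoeff incl x (fun i => b * a N i) (p.2 + 1))
  rw [← mem_antidiagonal.mp hp, pow_add, mul_comm ((√(N : ℝ))⁻¹ ^ p.1), mul_smul_comm,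
    mul_smul_comm, lmulMatrix_smul, smul_mul_assoc, smul_smul]

/-- One step of the computation of the limits of the rescaled moments. -/
theorem tendsto_moment_step {E : CondExp incl} {x : A} (hx : E x = 0) {η : B → B}
    (hη : ∀ b, E (x * incl b * x) = η b) (b : Matrix (Fin m) (Fin m) B)
    (a : ℕ → ℕ → Matrix (Fin m) (Fin m) B)
    (ha : ∀ N n, a (N + 1) n = ∑ p ∈ antidiagonal n, a N p.1 *
      (resolventCoeff incl x (fun i => b * a N i) p.2).map E)
    (α : ℕ → Matrix (Fin m) (Fin m) B) (n : ℕ)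
    (h : ∀ i ≤ n, Tendsto (fun N : ℕ => (√(N : ℝ))⁻¹ ^ i • a N i) atTop (𝓝 (α i))) :
    Tendsto (fun N : ℕ => (√(N : ℝ))⁻¹ ^ (n + 2) • a N (n + 2)) atTop
      (𝓝 ((2 / ((n : ℝ) + 2)) • ∑ p ∈ antidiagonal n, α p.1 *
        ∑ q ∈ antidiagonal p.2, (b * α q.1).map η * (b * α q.2))) := by
  set c := ∑ p ∈ antidiagonal n, α p.1 *
    ∑ q ∈ antidiagonal p.2, (b * α q.1).map η * (b * α q.2) with hc
  have hR1 : ∀ N, (resolventCoeff incl x (fun i => b * a N i) 1).map E = 0 := by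
    intro N
    rw [resolventCoeff_succ]
    simp [resolventCoeff_zero, E.map_matrix_lmul hx]
  -- The term with p.2 = 0 is `a N (n + 2)` itself and cancels; the one with p.2 = 1 vanishes by
  -- centering.
  have hdiff : Tendsto (fun N : ℕ => (√(N : ℝ))⁻¹ ^ n • (a (N + 1) (n + 2) - a N (n + 2)))
      atTop (𝓝 c) := by
    have key := tendsto_finsetSum (antidiagonal n) fun p hp =>
      (h p.1 (antidiagonal.fst_le hp)).mul (tendsto_map_resolventCoeff hx hη b a α p.2 fun i hi =>
          h i (hi.trans (antidiagonal.snd_le hp)))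
    refine key.congr fun N => ?_
    rw [ha, Finset.Nat.antidiagonal_succ', Finset.sum_cons, Finset.sum_map,
      Finset.Nat.antidiagonal_succ', Finset.sum_cons, Finset.sum_map, resolventCoeff_zero,
      E.map_matrix_one, mul_one, add_sub_cancel_left]
    simp only [Function.Embedding.coe_prodMap, Function.Embedding.coeFn_mk,
      Function.Embedding.coe_refl, Prod.map_apply, id_eq, Nat.succ_eq_add_one, zero_add, hR1, mul_zero,
      Finset.smul_sum]
    refine Finset.sum_congr rfl fun p hp => ?_
    rw [← mem_antidiagonal.mp hp, pow_add, smul_mul_assoc, mul_smul_comm, smul_smul]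
    rfl
  refine tendsto_pi_nhds.mpr fun i => tendsto_pi_nhds.mpr fun j => ?_
  have := tendsto_pi_nhds.mp (tendsto_pi_nhds.mp hdiff i) j
  exact tendsto_of_tendsto_sub n (fun N => a N (n + 2) i j) (c i j) this

/-- The rescaled moments converge, and the limits satisfy a recurrence. -/
theorem exists_tendsto_moment {E : CondExp incl} {x : A} (hx : E x = 0) {η : B → B}
    (hη : ∀ b, E (x * incl b * x) = η b) (b : Matrix (Fin m) (Fin m) B)
    (a : ℕ → ℕ → Matrix (Fin m) (Fin m) B)
    (ha : ∀ N n, a (N + 1) n = ∑ p ∈ antidiagonal n, a N p.1 *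
      (resolventCoeff incl x (fun i => b * a N i) p.2).map E)
    (ha0 : ∀ N, a N 0 = 1) (ha1 : ∀ N, a N 1 = 0) :
    ∃ α : ℕ → Matrix (Fin m) (Fin m) B,
      (∀ n, Tendsto (fun N : ℕ => (√(N : ℝ))⁻¹ ^ n • a N n) atTop (𝓝 (α n))) ∧
      α 0 = 1 ∧ α 1 = 0 ∧ ∀ n, α (n + 2) = (2 / ((n : ℝ) + 2)) •
        ∑ p ∈ antidiagonal n, α p.1 *
          ∑ q ∈ antidiagonal p.2, (b * α q.1).map η * (b * α q.2) := by
  have hex : ∀ n, ∃ l, Tendsto (fun N : ℕ => (√(N : ℝ))⁻¹ ^ n • a N n) atTop (𝓝 l) := by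
    intro n
    induction n using Nat.strong_induction_on with
    | _ n ih =>
    match n, ih with
    | 0, _ => exact ⟨1, by simp [ha0]⟩
    | 1, _ => exact ⟨0, by simp [ha1]⟩
    | n + 2, ih =>
      choose! l hl using ih
      exact ⟨_, tendsto_moment_step hx hη b a ha l n fun i hi => hl i (by omega)⟩
  choose α hα using hex
  refine ⟨α, hα, tendsto_nhds_unique (hα 0) (by simp [ha0]),
    tendsto_nhds_unique (hα 1) (by simp [ha1]), fun n => ?_⟩
  exact tendsto_nhds_unique (hα (n + 2)) (tendsto_moment_step hx hη b a ha α n fun i _ => hα i)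

end Limit

/-! ### The formal `B`-transform -/

section Formal

open PowerSeries in
/-- The Euler operator `t d/dt` on formal power series. -/
def eulerOp {R : Type*} [Ring R] [Module ℂ R] (f : PowerSeries R) : PowerSeries R :=
  PowerSeries.mk fun n => (n : ℂ) • coeff n f

open PowerSeries in
theorem eulerOp_mul {R : Type*} [Ring R] [Algebra ℂ R] (f g : PowerSeries R) :
    eulerOp (f * g) = eulerOp f * g + f * eulerOp g := by
  ext n
  simp only [eulerOp, coeff_mk, map_add, coeff_mul, Finset.smul_sum, ← Finset.sum_add_distrib]
  refine Finset.sum_congr rfl fun p hp => ?_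
  rw [← mem_antidiagonal.mp hp, Nat.cast_add, add_smul, smul_mul_assoc, mul_smul_comm]

open PowerSeries in
/-- The differential equations `a' = 2 a g a` and `β' = 2 g` (for the Euler operator) imply
`a = 1 + β a`. -/
theorem eq_one_add_mul_of_eulerOp {R : Type*} [Ring R] [Algebra ℂ R] (a β g : PowerSeries R)
    (ha : coeff 0 a = 1) (hβ : coeff 0 β = 0) (hg : coeff 0 g = 0)
    (hda : eulerOp a = (2 : ℂ) • (a * (g * a))) (hdβ : eulerOp β = (2 : ℂ) • g) :
    a = 1 + β * a ∧ a = 1 + a * β := by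
  set u := a - β * a with hu
  have hda' : ∀ n : ℕ, (n : ℂ) • coeff n a = (2 : ℂ) • coeff n (a * (g * a)) := fun n => by
    simpa [eulerOp] using congrArg (coeff n) hda
  have hdβa : ∀ n : ℕ, (n : ℂ) • coeff n (β * a) =
      (2 : ℂ) • coeff n (g * a) + (2 : ℂ) • coeff n (β * (a * (g * a))) := fun n => by
    have := congrArg (coeff n) (eulerOp_mul β a)
    rw [hda, hdβ, smul_mul_assoc, mul_smul_comm] at this
    simpa [eulerOp] using this
  have hdu : ∀ n : ℕ, (n : ℂ) • coeff n u = (2 : ℂ) • coeff n ((u - 1) * (g * a)) := by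
    intro n
    rw [hu, map_sub, smul_sub, hda', hdβa, ← smul_add, ← smul_sub, ← map_add, ← map_sub]
    congr 2
    noncomm_ring
  have hu0 : coeff 0 u = 1 := by
    rw [hu, map_sub, coeff_mul]
    simp [ha, hβ]
  have hga : coeff 0 (g * a) = 0 := by
    rw [coeff_mul]
    simp [hg]
  have h1 : ∀ n, coeff n (u - 1) = 0 := by
    intro n
    induction n using Nat.strong_induction_on with
    | _ n ih =>
    by_cases hn : n = 0
    · subst hn
      rw [map_sub, hu0]
      simp
    · have h2 : coeff n ((u - 1) * (g * a)) = 0 := by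
        rw [coeff_mul]
        refine Finset.sum_eq_zero fun p hp => ?_
        have := mem_antidiagonal.mp hp
        by_cases hp2 : p.2 = 0
        · rw [hp2, hga, mul_zero]
        · rw [ih p.1 (by omega), zero_mul]
      have h3 := hdu n
      rw [h2, smul_zero, smul_eq_zero_iff_right (by exact_mod_cast hn)] at h3
      rw [map_sub, h3, coeff_one, if_neg hn, sub_zero]
  have hu1 : u = 1 := by
    rw [← sub_eq_zero]
    ext n
    simpa using h1 n
  have hl : (1 - β) * a = 1 := by
    rw [sub_mul, one_mul, ← hu, hu1]
  -- Since `a` has constant term 1, it has a right inverse, which must agree with the left inverse 1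
  -- - β.
  have hr : a * (1 - β) = 1 := by
    have hinv := mul_invOfUnit a 1 (by simpa using ha)
    have : 1 - β = invOfUnit a 1 := by
      calc 1 - β = (1 - β) * (a * invOfUnit a 1) := by rw [hinv, mul_one]
        _ = _ := by rw [← mul_assoc, hl, one_mul]
    rw [this, hinv]
  constructor
  · rw [sub_mul, one_mul, sub_eq_iff_eq_add] at hl
    exact hl
  · rw [mul_sub, mul_one, sub_eq_iff_eq_add] at hr
    exact hr

/-- The recurrence of the moments in terms of the coefficients of the `B`-transform. -/
theorem eq_sum_antidiagonal_of_recurrence {R : Type*} [Ring R] [Algebra ℂ R] (α β γ : ℕ → R)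
    (h0 : α 0 = 1) (h1 : α 1 = 0)
    (hα : ∀ n, α (n + 2) = (2 / ((n : ℂ) + 2)) • ∑ p ∈ antidiagonal n, α p.1 *
      ∑ q ∈ antidiagonal p.2, γ q.1 * α q.2)
    (hβ0 : β 0 = 0) (hβ1 : β 1 = 0) (hβ : ∀ n, β (n + 2) = (2 / ((n : ℂ) + 2)) • γ n) (n : ℕ) :
    α n = (if n = 0 then 1 else 0) + ∑ p ∈ antidiagonal n, β p.1 * α p.2 ∧
    α n = (if n = 0 then 1 else 0) + ∑ p ∈ antidiagonal n, α p.1 * β p.2 := by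
  have hn2 : ∀ n : ℕ, ((n + 2 : ℕ) : ℂ) * (2 / ((n : ℂ) + 2)) = 2 := fun n => by
    have : (n : ℂ) + 2 ≠ 0 := by exact_mod_cast Nat.succ_ne_zero (n + 1)
    push_cast
    field_simp
  -- In the application γ n = η(b α_n) b contains two further factors `b`, so it sits in degree n +
  -- 2.
  let g : PowerSeries R := PowerSeries.X ^ 2 * PowerSeries.mk γ
  have key := eq_one_add_mul_of_eulerOp (PowerSeries.mk α) (PowerSeries.mk β) g
    (by simpa using h0) (by simpa using hβ0) (by simp [g]) ?_ ?_
  · have e1 := congrArg (PowerSeries.coeff n) key.1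
    have e2 := congrArg (PowerSeries.coeff n) key.2
    simp only [map_add, PowerSeries.coeff_mul, PowerSeries.coeff_mk, PowerSeries.coeff_one] at e1 e2
    exact ⟨e1, e2⟩
  · have hc : PowerSeries.mk α * (g * PowerSeries.mk α) = PowerSeries.X ^ 2 *
        (PowerSeries.mk α * (PowerSeries.mk γ * PowerSeries.mk α)) := by
      have := PowerSeries.X_pow_mul (φ := PowerSeries.mk α) (n := 2)
      simp only [g, ← mul_assoc, this]
    ext n
    rw [hc]
    match n with
    | 0 => simp [eulerOp]
    | 1 => simp [eulerOp, h1, PowerSeries.coeff_X_pow_mul']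
    | n + 2 =>
      simp only [eulerOp, PowerSeries.coeff_mk, PowerSeries.coeff_smul]
      rw [hα, smul_smul, hn2, add_comm n 2, PowerSeries.coeff_X_pow_mul']
      simp [PowerSeries.coeff_mul]
  · ext n
    match n with
    | 0 => simp [eulerOp, g]
    | 1 => simp [eulerOp, hβ1, g, PowerSeries.coeff_X_pow_mul']
    | n + 2 =>
      simp only [eulerOp, PowerSeries.coeff_mk, PowerSeries.coeff_smul]
      rw [hβ, smul_smul, hn2, PowerSeries.coeff_X_pow_mul']
      simp

/-- If n is odd, one of the three degrees summing to n is odd, and the corresponding factor vanishes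
by induction. -/
theorem odd_eq_zero_of_recurrence {R : Type*} [Ring R] [Algebra ℂ R] (α γ : ℕ → R)
    (h1 : α 1 = 0) (hγ : ∀ n, α n = 0 → γ n = 0)
    (hα : ∀ n, α (n + 2) = (2 / ((n : ℂ) + 2)) • ∑ p ∈ antidiagonal n, α p.1 *
      ∑ q ∈ antidiagonal p.2, γ q.1 * α q.2) (n : ℕ) (hn : Odd n) : α n = 0 := by
  induction n using Nat.strong_induction_on with
  | _ n ih =>
  match n, ih, hn with
  | 0, _, hn => exact absurd hn (by decide)
  | 1, _, _ => exact h1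
  | n + 2, ih, hn =>
    rw [hα, Finset.sum_eq_zero, smul_zero]
    intro p hp
    have hp := mem_antidiagonal.mp hp
    have hn' : Odd n := by
      rcases hn with ⟨k, hk⟩
      exact ⟨k - 1, by omega⟩
    rcases Nat.even_or_odd p.1 with he | ho
    · rw [Finset.sum_eq_zero, mul_zero]
      intro q hq
      have hq := mem_antidiagonal.mp hq
      have hp2 : Odd (q.1 + q.2) := by
        rw [hq]
        rw [← hp] at hn'
        exact (Nat.odd_add'.mp hn').mpr he
      rcases Nat.even_or_odd q.1 with he' | ho'
      · have : Odd q.2 := (Nat.odd_add'.mp hp2).mpr he'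
        rw [ih q.2 (by omega) this, mul_zero]
      · rw [hγ q.1 (ih q.1 (by omega) ho'), zero_mul]
    · rw [ih p.1 (by omega) ho, zero_mul]

end Formal

/-! ### Absolute convergence and invertibility of the moment series. -/

section Summability

/-- A quadratic majorant gives summability. -/
theorem summable_of_quadratic_recurrence (v w : ℕ → ℝ) (κ : ℝ) (hκ0 : 0 ≤ κ) (hκ : κ ≤ 1 / 4)
    (hv : ∀ n, 0 ≤ v n) (hw : ∀ n, 0 ≤ w n) (hw0 : w 0 = 0) (hw1 : w 1 = 0)
    (hw2 : ∀ n, w (n + 2) ≤ κ * v n)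
    (hvw : ∀ n, v n ≤ (if n = 0 then 1 else 0) + ∑ p ∈ antidiagonal n, w p.1 * v p.2) :
    Summable v ∧ Summable w := by
  have hW : ∀ N, ∑ i ∈ Finset.range N, w (i + 1) ≤ κ * ∑ i ∈ Finset.range N, v i := by
    intro N
    cases N with
    | zero => simp
    | succ N =>
      rw [Finset.sum_range_succ', hw1, add_zero, Finset.sum_range_succ, mul_add, Finset.mul_sum]
      exact (Finset.sum_le_sum fun i _ => hw2 i).trans
        (le_add_of_nonneg_right (mul_nonneg hκ0 (hv N)))
  have hC : ∀ N, ∑ n ∈ Finset.range N, ∑ p ∈ antidiagonal n, w (p.1 + 1) * v p.2 ≤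
      (∑ i ∈ Finset.range N, w (i + 1)) * ∑ i ∈ Finset.range N, v i := by
    intro N
    have e : ∀ n, ∑ p ∈ antidiagonal n, w (p.1 + 1) * v p.2 =
        ∑ k ∈ Finset.range (n + 1), w (k + 1) * v (n - k) := fun n =>
      Finset.Nat.sum_antidiagonal_eq_sum_range_succ (fun i j => w (i + 1) * v j) n
    simp only [e]
    rw [Finset.sum_range_diag_flip N fun i j => w (i + 1) * v j, Finset.sum_mul]
    refine Finset.sum_le_sum fun i _ => ?_
    rw [← Finset.mul_sum]
    refine mul_le_mul_of_nonneg_left ?_ (hw _)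
    exact Finset.sum_le_sum_of_subset_of_nonneg
      (Finset.range_subset_range.mpr (Nat.sub_le N i)) fun j _ _ => hv j
  -- The partial sums satisfy S_{N+1} ≤ 1 + κ S_N², and 2 is the fixed point of t ↦ 1 + t²/4.
  have hV : ∀ N, ∑ i ∈ Finset.range N, v i ≤ 2 := by
    intro N
    induction N with
    | zero => simp
    | succ N ih =>
      set S := ∑ i ∈ Finset.range N, v i
      have hS : 0 ≤ S := Finset.sum_nonneg fun i _ => hv i
      have h1 : ∑ n ∈ Finset.range (N + 1), v n ≤ 1 + ∑ n ∈ Finset.range N,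
          ∑ p ∈ antidiagonal n, w (p.1 + 1) * v p.2 := by
        refine (Finset.sum_le_sum fun n _ => hvw n).trans ?_
        rw [Finset.sum_add_distrib, Finset.sum_range_succ' (fun n => ∑ p ∈ antidiagonal n, _)]
        refine add_le_add (by simp) (le_of_eq ?_)
        simp [Finset.Nat.antidiagonal_succ, hw0]
      have h2 := (hC N).trans (mul_le_mul_of_nonneg_right (hW N) hS)
      have h3 : κ * S * S ≤ 1 / 4 * 2 * 2 := by gcongr
      change _ ≤ κ * S * S at h2
      linarith
  have hsv : Summable v := summable_of_sum_range_le hv hV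
  refine ⟨hsv, (summable_nat_add_iff 2).mp ?_⟩
  exact (hsv.mul_left κ).of_nonneg_of_le (fun n => hw _) hw2

/-- Absolutely summable solutions of `a = 1 + β a = 1 + a β`. -/
theorem isUnit_tsum_of_recurrence {R : Type*} [NormedRing R] [CompleteSpace R] (α β : ℕ → R)
    (hl : ∀ n, α n = (if n = 0 then 1 else 0) + ∑ p ∈ antidiagonal n, β p.1 * α p.2)
    (hr : ∀ n, α n = (if n = 0 then 1 else 0) + ∑ p ∈ antidiagonal n, α p.1 * β p.2)
    (hα : Summable fun n => ‖α n‖) (hβ : Summable fun n => ‖β n‖) :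
    IsUnit (∑' n, α n) ∧ (∑' n, α n - 1) * Ring.inverse (∑' n, α n) = ∑' n, β n := by
  have h1 : HasSum (fun n : ℕ => if n = 0 then (1 : R) else 0) 1 := hasSum_ite_eq 0 1
  have el : ∑' n, α n = 1 + (∑' n, β n) * ∑' n, α n := by
    rw [tsum_mul_tsum_eq_tsum_sum_antidiagonal_of_summable_norm hβ hα]
    have h2 := (summable_norm_sum_mul_antidiagonal_of_summable_norm hβ hα).of_norm.hasSum
    exact (tsum_congr hl).trans (h1.add h2).tsum_eq
  have er : ∑' n, α n = 1 + (∑' n, α n) * ∑' n, β n := by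
    rw [tsum_mul_tsum_eq_tsum_sum_antidiagonal_of_summable_norm hα hβ]
    have h2 := (summable_norm_sum_mul_antidiagonal_of_summable_norm hα hβ).of_norm.hasSum
    exact (tsum_congr hr).trans (h1.add h2).tsum_eq
  set M := ∑' n, α n
  set S := ∑' n, β n
  -- The two identities make 1 - S a two-sided inverse of `M`.
  have hu : IsUnit M := by
    refine ⟨⟨M, 1 - S, ?_, ?_⟩, rfl⟩
    · rw [mul_sub, mul_one, sub_eq_iff_eq_add]; exact er
    · rw [sub_mul, one_mul, sub_eq_iff_eq_add]; exact el
  refine ⟨hu, ?_⟩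
  have : M - 1 = S * M := by rw [sub_eq_iff_eq_add']; exact el
  rw [this, mul_assoc, Ring.mul_inverse_cancel _ hu, mul_one]

end Summability

/-! ### Existence of the limit distribution -/

section WeakLimit

variable {B : Type*} [CStarAlgebra B] [PartialOrder B] [StarOrderedRing B]
  {A : Type*} [CStarAlgebra A] {incl : B →⋆ₐ[ℂ] A} {m : ℕ}

/-- Every axiom of a positive conditional expectation survives pointwise norm limits, the positive
cone being closed. -/
theorem exists_weakLimit (σ : ℕ → Distribution B)
    (h : ∀ p : NCPoly B, ∃ l, Tendsto (fun N => σ N p) atTop (𝓝 l)) :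
    ∃ μ : Distribution B, WeakLimit σ μ := by
  choose l hl using h
  refine ⟨⟨⟨⟨l, fun p q => ?_⟩, fun z p => ?_⟩, fun b p c => ?_, fun b => ?_, fun p => ?_⟩, hl⟩
  · refine tendsto_nhds_unique (hl (p + q)) (((hl p).add (hl q)).congr fun N => ?_)
    rw [map_add]
  · refine tendsto_nhds_unique (hl (z • p)) (((hl p).const_smul z).congr fun N => ?_)
    rw [map_smul]
  · refine tendsto_nhds_unique (hl _) ((((hl p).const_mul b).mul_const c).congr fun N => ?_)
    rw [(σ N).map_bimodule]
  · refine tendsto_nhds_unique (hl _) (tendsto_const_nhds.congr fun N => ?_)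
    rw [(σ N).map_incl]
  · exact ge_of_tendsto' (hl _) fun N => (σ N).nonneg p

theorem NCPoly.mem_span_words (p : NCPoly B) :
    p ∈ Submodule.span ℂ {q : NCPoly B | ∃ (c : B) (l : List B),
      q = NCPoly.C B c * (l.map fun b => NCPoly.X B * NCPoly.C B b).prod} := by
  set W := Submodule.span ℂ {q : NCPoly B | ∃ (c : B) (l : List B),
      q = NCPoly.C B c * (l.map fun b => NCPoly.X B * NCPoly.C B b).prod} with hW
  -- Being stable under left multiplication and containing 1, the span is everything.
  have key : ∀ w ∈ W, p * w ∈ W := by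
    induction p using NCPoly.induction with
    | hC b =>
      intro w hw
      induction hw using Submodule.span_induction with
      | zero => simp
      | add x y _ _ hx hy => rw [mul_add]; exact add_mem hx hy
      | smul z x _ hx => rw [mul_smul_comm]; exact W.smul_mem _ hx
      | mem w hw =>
        obtain ⟨c, l, rfl⟩ := hw
        refine Submodule.subset_span ⟨b * c, l, ?_⟩
        rw [map_mul, mul_assoc]
        rfl
    | hX =>
      intro w hw
      induction hw using Submodule.span_induction with
      | zero => simp
      | add x y _ _ hx hy => rw [mul_add]; exact add_mem hx hy
      | smul z x _ hx => rw [mul_smul_comm]; exact W.smul_mem _ hx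
      | mem w hw =>
        obtain ⟨c, l, rfl⟩ := hw
        exact Submodule.subset_span ⟨1, c :: l, by simp [mul_assoc]⟩
    | hadd p q hp hq =>
      intro w hw
      rw [add_mul]
      exact add_mem (hp w hw) (hq w hw)
    | hmul p q hp hq =>
      intro w hw
      rw [mul_assoc]
      exact hp _ (hq w hw)
  simpa using key 1 (Submodule.subset_span ⟨1, [], by simp⟩)

/-- Words are entries of powers of superdiagonal matrices. -/
theorem superdiagonal_pow_apply (x : A) (l : List B) (k : ℕ) (hk : k ≤ l.length) :
    (lmulMatrix incl x (Matrix.of fun i j : Fin (l.length + 1) =>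
      if (j : ℕ) = i + 1 then l.getD i 0 else 0) ^ k) 0 ⟨k, by omega⟩ =
    ((l.take k).map fun b => x * incl b).prod := by
  induction k with
  | zero => simp
  | succ k ih =>
    rw [pow_succ, Matrix.mul_apply, Finset.sum_eq_single ⟨k, by omega⟩]
    · rw [ih (by omega), List.take_add_one, List.map_append, List.prod_append]
      congr 1
      simp [lmulMatrix, List.getD_eq_getElem?_getD,
        List.getElem?_eq_getElem (show k < l.length by omega)]
    · intro r _ hr
      have : ¬ (k + 1 = (r : ℕ) + 1) := fun h => hr (Fin.ext (by simp; omega))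
      simp only [lmulMatrix, Matrix.of_apply, if_neg this, map_zero, mul_zero]
    · simp

/-- By linearity one word suffices, and its expectation can be read off a corner entry of a moment
of a superdiagonal matrix. -/
theorem exists_tendsto_of_tendsto_matrixMoment (E : CondExp incl) (S : ℕ → A)
    (h : ∀ (m : ℕ) (b : Matrix (Fin m) (Fin m) B) (n : ℕ),
      ∃ l, Tendsto (fun N => matrixMoment E (S N) b n) atTop (𝓝 l)) (p : NCPoly B) :
    ∃ l, Tendsto (fun N => E (NCPoly.eval incl (S N) p)) atTop (𝓝 l) := by
  induction NCPoly.mem_span_words p using Submodule.span_induction with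
  | zero => exact ⟨0, by simp⟩
  | add x y _ _ hx hy =>
    obtain ⟨l, hl⟩ := hx
    obtain ⟨l', hl'⟩ := hy
    exact ⟨l + l', by simpa using hl.add hl'⟩
  | smul z x _ hx =>
    obtain ⟨l, hl⟩ := hx
    exact ⟨z • l, by simpa using hl.const_smul z⟩
  | mem p hp =>
    obtain ⟨c, w, rfl⟩ := hp
    obtain ⟨l, hl⟩ := h (w.length + 1) (Matrix.of fun i j : Fin (w.length + 1) =>
      if (j : ℕ) = i + 1 then w.getD i 0 else 0) w.length
    have hl' := tendsto_pi_nhds.mp (tendsto_pi_nhds.mp hl 0) ⟨w.length, by omega⟩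
    refine ⟨_, (hl'.const_mul c).congr fun N => ?_⟩
    rw [map_mul, NCPoly.eval_C, E.map_incl_mul, matrixMoment, Matrix.map_apply,
      superdiagonal_pow_apply _ _ _ le_rfl, List.take_length,
      map_list_prod (NCPoly.eval incl (S N)), List.map_map]
    congr 3
    refine List.map_congr_left fun b _ => ?_
    simp [NCPoly.eval_X, NCPoly.eval_C]

theorem eval_pow_apply (x : A) (b : Matrix (Fin m) (Fin m) B) (n : ℕ) (i j : Fin m) :
    NCPoly.eval incl x (((Matrix.of fun i j => NCPoly.X B * NCPoly.C B (b i j)) ^ n) i j) =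
      (lmulMatrix incl x b ^ n) i j := by
  have e : (NCPoly.eval incl x).mapMatrix (Matrix.of fun i j => NCPoly.X B * NCPoly.C B (b i j)) =
      lmulMatrix incl x b := by
    ext i j
    simp [lmulMatrix, NCPoly.eval_X, NCPoly.eval_C]
  rw [← e, ← map_pow (NCPoly.eval incl x).mapMatrix]
  rfl

theorem moment_law_apply (E : CondExp incl) (x : A) (hx : IsSelfAdjoint x) (b : Mat m B) (n : ℕ)
    (i j : Fin m) : moment (law E x hx) n b i j = matrixMoment E x b n i j :=
  congrArg E (eval_pow_apply x b n i j)

theorem matrixMoment_smul (E : CondExp incl) (x : A) (r : ℝ) (b : Matrix (Fin m) (Fin m) B)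
    (n : ℕ) : matrixMoment E (r • x) b n = r ^ n • matrixMoment E x b n := by
  have : lmulMatrix incl (r • x) b = r • lmulMatrix incl x b := by
    ext i j
    simp [lmulMatrix]
  rw [matrixMoment, matrixMoment, this, smul_pow, E.map_matrix_smul]

/-- The linear map b ↦ 𝒳 b extends to a homomorphism from the tensor algebra into `B⟨𝒳⟩`, which
carries nilpotency over to the matrix 𝒳 b. -/
theorem moment_eq_zero_of_isTensorNilpotent {b : Mat m B} (hb : IsTensorNilpotent b) :
    ∃ r : ℕ, ∀ (μ : Distribution B) (n : ℕ), r ≤ n → moment μ n b = 0 := by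
  obtain ⟨r, hr⟩ := hb
  refine ⟨r, fun μ n hn => ?_⟩
  let φ : TensorAlgebra ℂ B →ₐ[ℂ] NCPoly B := TensorAlgebra.lift ℂ
    ((LinearMap.mulLeft ℂ (NCPoly.X B)).comp (NCPoly.C B).toAlgHom.toLinearMap)
  have e : φ.mapMatrix (Matrix.of fun i j => TensorAlgebra.ι ℂ (b i j)) =
      Matrix.of fun i j => NCPoly.X B * NCPoly.C B (b i j) := by
    ext i j
    simp [φ]
  have h0 : (Matrix.of fun i j => NCPoly.X B * NCPoly.C B (b i j)) ^ n = 0 := by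
    refine pow_eq_zero_of_le hn ?_
    rw [← e, ← map_pow, hr, map_zero]
  rw [moment, h0]
  ext i j
  exact map_zero μ.toLinearMap

/-- Since the zeroth moment is 1, the recurrence is triangular and determines the coefficients
uniquely. -/
theorem BCoeff_eq_of_recurrence (μ : Distribution B) (b : Mat m B) (β : ℕ → Mat m B)
    (h0 : moment μ 0 b = 1) (hβ0 : β 0 = 0)
    (h : ∀ n, moment μ n b = (if n = 0 then 1 else 0) +
      ∑ p ∈ antidiagonal n, β p.1 * moment μ p.2 b) (n : ℕ) : BCoeff μ n b = β n := by
  induction n using Nat.strong_induction_on with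
  | _ n ih =>
  cases n with
  | zero => rw [BCoeff, hβ0]
  | succ n =>
    rw [BCoeff, h (n + 1), if_neg (Nat.succ_ne_zero n), zero_add,
      Finset.Nat.sum_antidiagonal_eq_sum_range_succ (fun i j => β i * moment μ j b),
      Finset.sum_range_succ, Nat.sub_self, h0, mul_one,
      Fin.sum_univ_eq_sum_range (fun k => BCoeff μ k b * moment μ (n + 1 - k) b),
      sub_eq_iff_eq_add, add_comm]
    congr 1
    exact Finset.sum_congr rfl fun k hk => by rw [ih k (Finset.mem_range.mp hk)]

end WeakLimit

/-! ### The arcsine law -/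

section Arcsine

variable {B : Type*} [CStarAlgebra B] [PartialOrder B] [StarOrderedRing B]
  {A : Type*} [CStarAlgebra A] {incl : B →⋆ₐ[ℂ] A} {m : ℕ}

theorem exists_tendsto_matrixMoment_normalizedSum {E : CondExp incl} {X : ℕ → A}
    (hcentered : ∀ i, E (X i) = 0)
    (hid : ∀ i k, ∀ p : NCPoly B, E (NCPoly.eval incl (X i) p) = E (NCPoly.eval incl (X k) p))
    (hindep : MonotoneIndep E X) {η : B → B} (hη : ∀ b, E (X 0 * incl b * X 0) = η b)
    (b : Matrix (Fin m) (Fin m) B) :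
    ∃ α : ℕ → Matrix (Fin m) (Fin m) B,
      (∀ n, Tendsto (fun N : ℕ => matrixMoment E (normalizedSum X N) b n) atTop (𝓝 (α n))) ∧
      α 0 = 1 ∧ α 1 = 0 ∧ ∀ n, α (n + 2) = (2 / ((n : ℂ) + 2)) •
        ∑ p ∈ antidiagonal n, α p.1 *
          ∑ q ∈ antidiagonal p.2, (b * α q.1).map η * b * α q.2 := by
  obtain ⟨α, hα, h0, h1, hrec⟩ := exists_tendsto_moment (hcentered 0) hη b
    (fun N n => matrixMoment E (∑ i ∈ Finset.range N, X i) b n)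
    (fun N n => hindep.matrixMoment_sum_succ hid b N n)
    (fun N => by simp only [matrixMoment, pow_zero, E.map_matrix_one])
    (fun N => by
      rw [matrixMoment, pow_one]
      exact CondExp.map_matrix_lmul
        (by rw [map_sum]; exact Finset.sum_eq_zero fun i _ => hcentered i) b)
  refine ⟨α, fun n => (hα n).congr fun N => (matrixMoment_smul E _ _ b n).symm, h0, h1,
    fun n => ?_⟩
  rw [hrec]
  simp only [mul_assoc]
  ext i j
  rw [Matrix.smul_apply, Matrix.smul_apply, ← Complex.coe_smul]
  push_cast
  rfl

/-- The candidates for the coefficients of the `B`-transform of a law with moments `α`. -/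
def arcsineBCoeff (η : B → B) (b : Mat m B) (α : ℕ → Mat m B) : ℕ → Mat m B
  | 0 => 0
  | 1 => 0
  | n + 2 => (2 / ((n : ℂ) + 2)) • ((b * α n).map η * b)

/-- Only an inequality, because the matrix algebra is zero when m = 0 or `B` is trivial. -/
theorem norm_one_mat_le (m : ℕ) : ‖(1 : Mat m B)‖ ≤ 1 := by
  rcases subsingleton_or_nontrivial (Mat m B) with h | h
  · rw [Subsingleton.elim (1 : Mat m B) 0, norm_zero]
    exact zero_le_one
  · exact CStarRing.norm_one.le

theorem arcsineBCoeff_recurrence (η : B → B) (b : Mat m B) (α : ℕ → Mat m B) (h0 : α 0 = 1)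
    (h1 : α 1 = 0) (hα : ∀ n, α (n + 2) = (2 / ((n : ℂ) + 2)) •
        ∑ p ∈ antidiagonal n, α p.1 *
          ∑ q ∈ antidiagonal p.2, (b * α q.1).map η * b * α q.2) (n : ℕ) :
    α n = (if n = 0 then 1 else 0) + ∑ p ∈ antidiagonal n, arcsineBCoeff η b α p.1 * α p.2 ∧
    α n = (if n = 0 then 1 else 0) + ∑ p ∈ antidiagonal n, α p.1 * arcsineBCoeff η b α p.2 :=
  eq_sum_antidiagonal_of_recurrence α (arcsineBCoeff η b α) (fun k => (b * α k).map η * b)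
    h0 h1 hα rfl rfl (fun _ => rfl) n

theorem arcsineBCoeff_eq_zero {η : B → B} (hη : η 0 = 0) (b : Mat m B) (α : ℕ → Mat m B) (n : ℕ)
    (h : α n = 0) : arcsineBCoeff η b α (n + 2) = 0 := by
  have : (b * α n).map η = 0 := by
    rw [h, mul_zero]
    ext i j
    simp [hη]
  rw [arcsineBCoeff, this, zero_mul, smul_zero]

theorem arcsineBCoeff_odd {η : B → B} (hη : η 0 = 0) (b : Mat m B) (α : ℕ → Mat m B)
    (hodd : ∀ n, Odd n → α n = 0) (n : ℕ) : arcsineBCoeff η b α (2 * n + 1) = 0 := by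
  cases n with
  | zero => rfl
  | succ n => exact arcsineBCoeff_eq_zero hη b α (2 * n + 1) (hodd _ ⟨n, rfl⟩)

theorem arcsineBCoeff_even (η : B → B) (b : Mat m B) (α : ℕ → Mat m B) (n : ℕ) :
    arcsineBCoeff η b α (2 * n + 2) = ((n : ℂ) + 1)⁻¹ • ((b * α (2 * n)).map η * b) := by
  rw [arcsineBCoeff]
  congr 1
  have : (n : ℂ) + 1 ≠ 0 := by exact_mod_cast Nat.succ_ne_zero n
  push_cast
  field_simp

theorem norm_arcsineBCoeff_le {η : B → B} {K : ℝ} (hK : 0 ≤ K) (b : Mat m B)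
    (hη : ∀ c : Mat m B, ‖c.map η‖ ≤ K * ‖c‖) (α : ℕ → Mat m B) (n : ℕ) :
    ‖arcsineBCoeff η b α (n + 2)‖ ≤ K * ‖b‖ ^ 2 * ‖α n‖ := by
  have h1 : ‖(2 / ((n : ℂ) + 2))‖ ≤ 1 := by
    have : (2 / ((n : ℂ) + 2)) = ((2 / ((n : ℝ) + 2) : ℝ) : ℂ) := by push_cast; rfl
    rw [this, Complex.norm_real, Real.norm_of_nonneg (by positivity)]
    rw [div_le_one (by positivity)]
    have : (0 : ℝ) ≤ n := Nat.cast_nonneg n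
    linarith
  calc ‖arcsineBCoeff η b α (n + 2)‖ = ‖(2 / ((n : ℂ) + 2))‖ * ‖(b * α n).map η * b‖ :=
        norm_smul _ _
    _ ≤ 1 * (K * (‖b‖ * ‖α n‖) * ‖b‖) := by
        refine mul_le_mul h1 ((norm_mul_le _ _).trans ?_) (norm_nonneg _) zero_le_one
        gcongr
        exact (hη _).trans (mul_le_mul_of_nonneg_left (norm_mul_le _ _) hK)
    _ = _ := by ring

theorem summable_arcsine {η : B → B} {K : ℝ} (hK : 0 ≤ K) (b : Mat m B)
    (hη : ∀ c : Mat m B, ‖c.map η‖ ≤ K * ‖c‖) (hb : K * ‖b‖ ^ 2 ≤ 1 / 4) (α : ℕ → Mat m B)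
    (hα : ∀ n, α n = (if n = 0 then 1 else 0) +
      ∑ p ∈ antidiagonal n, arcsineBCoeff η b α p.1 * α p.2) :
    (Summable fun n => ‖α n‖) ∧ Summable fun n => ‖arcsineBCoeff η b α n‖ := by
  refine summable_of_quadratic_recurrence _ _ (K * ‖b‖ ^ 2) (by positivity) hb
    (fun n => norm_nonneg _) (fun n => norm_nonneg _) (norm_zero) (norm_zero)
    (norm_arcsineBCoeff_le hK b hη α) fun n => ?_
  have h1 : ‖(if n = 0 then 1 else 0 : Mat m B)‖ ≤ if n = 0 then 1 else 0 := by
    split_ifs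
    exacts [norm_one_mat_le m, norm_zero.le]
  calc ‖α n‖ = _ := congrArg norm (hα n)
    _ ≤ _ := (norm_add_le _ _).trans (add_le_add h1 ((norm_sum_le _ _).trans
      (Finset.sum_le_sum fun p _ => norm_mul_le _ _)))

end Arcsine

end OpValued
end

theorem mainTheorem5 {B A : Type*} [CStarAlgebra B] [PartialOrder B] [StarOrderedRing B]
    [CStarAlgebra A] (incl : B →⋆ₐ[ℂ] A) (E : OpValued.CondExp incl)
    (X : ℕ → A) (hX : ∀ i, IsSelfAdjoint (X i))
    (hcentered : ∀ i, E (X i) = 0)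
    (hid : ∀ i k, OpValued.law E (X i) (hX i) = OpValued.law E (X k) (hX k))
    (hindep : OpValued.MonotoneIndep E X)
    (η : B → B) (hη : ∀ i b, E (X i * incl b * X i) = η b) :
    ∃ 𝔞 : OpValued.Distribution B,
      OpValued.WeakLimit
        (fun N => OpValued.law E (OpValued.normalizedSum X N)
          (OpValued.normalizedSum_isSelfAdjoint hX N)) 𝔞 ∧
      -- the homogeneous components of the B-transform
      (∀ (m : ℕ) (b : OpValued.Mat m B) (n : ℕ), 1 ≤ n →
        OpValued.BCoeff 𝔞 (2 * n) b =
          (n : ℂ)⁻¹ • ((b * OpValued.moment 𝔞 (2 * n - 2) b).map η * b)) ∧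
      (∀ (m : ℕ) (b : OpValued.Mat m B) (n : ℕ), OpValued.BCoeff 𝔞 (2 * n + 1) b = 0) ∧
      -- the B-transform as a function on a ball around 0 and on nilpotent matrices
      ∃ r : ℝ, 0 < r ∧ ∀ (m : ℕ) (b : OpValued.Mat m B),
        ‖b‖ < r ∨ OpValued.IsTensorNilpotent b →
          Summable (fun n => OpValued.moment 𝔞 n b) ∧
          IsUnit (OpValued.momentSeries 𝔞 b) ∧
          HasSum (fun k : ℕ => OpValued.BCoeff 𝔞 k b) (OpValued.BTransform 𝔞 b) ∧
          HasSum (fun n : ℕ => ((n : ℂ) + 1)⁻¹ •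
            ((b * OpValued.moment 𝔞 (2 * n) b).map η * b)) (OpValued.BTransform 𝔞 b) := by
  open OpValued in
  have hid' : ∀ i k, ∀ p : NCPoly B,
      E (NCPoly.eval incl (X i) p) = E (NCPoly.eval incl (X k) p) := fun i k p =>
    congrArg (fun μ : Distribution B => μ p) (hid i k)
  have hη0 : η 0 = 0 := by rw [← hη 0]; simp
  have hlim {m : ℕ} (b : Matrix (Fin m) (Fin m) B) :=
    exists_tendsto_matrixMoment_normalizedSum hcentered hid' hindep (hη 0) b
  obtain ⟨𝔞, h𝔞⟩ := exists_weakLimit (fun N => law E (normalizedSum X N)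
      (normalizedSum_isSelfAdjoint hX N))
    (exists_tendsto_of_tendsto_matrixMoment E (normalizedSum X) fun m b n => by
      obtain ⟨α, hα, -⟩ := hlim b
      exact ⟨α n, hα n⟩)
  have hmom : ∀ (m : ℕ) (b : Mat m B), moment 𝔞 0 b = 1 ∧ moment 𝔞 1 b = 0 ∧
      ∀ n, moment 𝔞 (n + 2) b = (2 / ((n : ℂ) + 2)) •
        ∑ p ∈ antidiagonal n, moment 𝔞 p.1 b *
          ∑ q ∈ antidiagonal p.2, (b * moment 𝔞 q.1 b).map η * b * moment 𝔞 q.2 b := by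
    intro m b
    obtain ⟨α, hα, h0, h1, hrec⟩ := hlim b
    -- Weak convergence, applied to the entries of [𝒳 b]^n, identifies the moments of the limit law
    -- with the limits of the moments.
    have e : (fun n => moment 𝔞 n b) = α := by
      funext n
      ext i j
      exact tendsto_nhds_unique (h𝔞 _) ((tendsto_pi_nhds.mp (tendsto_pi_nhds.mp (hα n) i) j).congr
        fun N => (moment_law_apply E _ (normalizedSum_isSelfAdjoint hX N) b n i j).symm)
    subst e
    exact ⟨h0, h1, hrec⟩
  have hrec : ∀ (m : ℕ) (b : Mat m B) (n : ℕ), _ := fun m b n =>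
    arcsineBCoeff_recurrence η b (fun n => moment 𝔞 n b) (hmom m b).1 (hmom m b).2.1
      (hmom m b).2.2 n
  have hodd : ∀ (m : ℕ) (b : Mat m B) (n : ℕ), Odd n → moment 𝔞 n b = 0 := fun m b n hn =>
    odd_eq_zero_of_recurrence (fun n => moment 𝔞 n b) (fun k => (b * moment 𝔞 k b).map η * b)
      (hmom m b).2.1 (fun k hk => by
        have hk : moment 𝔞 k b = 0 := hk
        have : (b * moment 𝔞 k b).map η = 0 := by
          rw [hk, mul_zero]
          ext i j
          simp [hη0]
        rw [this, zero_mul]) (hmom m b).2.2 n hn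
  have hB : ∀ (m : ℕ) (b : Mat m B) (n : ℕ),
      BCoeff 𝔞 n b = arcsineBCoeff η b (fun n => moment 𝔞 n b) n := fun m b n =>
    BCoeff_eq_of_recurrence 𝔞 b _ (hmom m b).1 rfl (fun n => (hrec m b n).1) n
  obtain ⟨K, hK0, hK⟩ := exists_covariance_bound E (X 0) η (hη 0)
  -- The radius ensures K‖b‖² ≤ K / (4(K + 1)²) ≤ 1/4, as the majorant requires; K + 1 avoids
  -- dividing by zero.
  refine ⟨𝔞, h𝔞, fun m b n hn => ?_, fun m b n => ?_, (2 * (K + 1))⁻¹, by positivity,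
    fun m b hb => ?_⟩
  · obtain ⟨n, rfl⟩ := Nat.exists_eq_add_of_le' hn
    rw [hB, show 2 * (n + 1) = 2 * n + 2 by ring, arcsineBCoeff_even, Nat.add_sub_cancel]
    push_cast
    rfl
  · rw [hB]
    exact arcsineBCoeff_odd hη0 b _ (hodd m b) n
  · set α : ℕ → Mat m B := fun n => moment 𝔞 n b with hα
    have hsum : (Summable fun n => ‖α n‖) ∧ Summable fun n => ‖arcsineBCoeff η b α n‖ := by
      rcases hb with hb | hb
      · refine summable_arcsine hK0 b (hK m) ?_ α fun n => (hrec m b n).1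
        have h1 : ‖b‖ ^ 2 ≤ ((2 * (K + 1))⁻¹) ^ 2 :=
          pow_le_pow_left₀ (norm_nonneg b) hb.le 2
        calc K * ‖b‖ ^ 2 ≤ K * ((2 * (K + 1))⁻¹) ^ 2 := by gcongr
          _ = 1 / 4 * (K / (K + 1) ^ 2) := by field_simp; ring
          _ ≤ 1 / 4 * 1 := by
            gcongr
            rw [div_le_one (by positivity)]
            nlinarith
          _ = 1 / 4 := by norm_num
      · obtain ⟨r, hr⟩ := moment_eq_zero_of_isTensorNilpotent hb
        have h0 : ∀ n, r ≤ n → α n = 0 := hr 𝔞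
        constructor
        · refine summable_of_ne_finset_zero (s := Finset.range r) fun n hn => ?_
          rw [h0 n (by simpa using hn), norm_zero]
        · refine (summable_nat_add_iff 2).mp
            (summable_of_ne_finset_zero (s := Finset.range r) fun n hn => ?_)
          rw [arcsineBCoeff_eq_zero hη0 b α n (h0 n (by simpa using hn)), norm_zero]
    obtain ⟨hunit, hT⟩ := isUnit_tsum_of_recurrence α (arcsineBCoeff η b α)
      (fun n => (hrec m b n).1) (fun n => (hrec m b n).2) hsum.1 hsum.2
    have hHas : HasSum (arcsineBCoeff η b α) (BTransform 𝔞 b) := by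
      have : BTransform 𝔞 b = ∑' n, arcsineBCoeff η b α n := hT
      rw [this]
      exact hsum.2.of_norm.hasSum
    refine ⟨hsum.1.of_norm, hunit, ?_, ?_⟩
    · simpa only [hB] using hHas
    -- The indices missed by n ↦ 2n + 2 are 0 and the odd ones, where the coefficients vanish.
    · have hinj : Function.Injective fun n : ℕ => 2 * n + 2 := fun i j h => by
        simp only at h
        omega
      have := (hinj.hasSum_iff (f := arcsineBCoeff η b α) (a := BTransform 𝔞 b) fun k hk => ?_).mpr
        hHas
      · simpa only [Function.comp_def, arcsineBCoeff_even] using this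
      · rcases Nat.even_or_odd' k with ⟨n, rfl | rfl⟩
        · cases n with
          | zero => rfl
          | succ n => exact absurd ⟨n, by ring⟩ hk
        · exact arcsineBCoeff_odd hη0 b α (hodd m b) n
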